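/- Let $M$ be a smooth finite-dimensional manifold (Hausdorff, second countable, without boundary, not necessarily compact) and let $f\colon M\to M$ be a $C^1$-diffeomorphism. Let $\Lambda\subset M$ be a compact set with $f(\Lambda)=\Lambda$ that is uniformly hyperbolic: the restriction of the tangent bundle splits as a direct sum $TM|\Lambda=E^s\oplus E^u$ of two continuous subbundles with $D_xf(E^s_x)=E^s_{f(x)}$ and $D_xf(E^u_x)=E^u_{f(x)}$ for all $x\in\Lambda$, and, for some continuous Riemannian metric on $M$, there are $0<\lambda<1$ and $C>0$ such that for all $x\in\Lambda$ and $n\ge 0$ $$\|D_xf^n v\|\le C\lambda^n\|v\|\ \ (v\in E^s_x),\qquad \|D_xf^{-n}v\|\le C\lambda^n\|v\|\ \ (v\in E^u_x).$$ Theorem (Anosov). The set $\Lambda$ is structurally stable. That is, for every neighbourhood $W$ of the inclusion $\Lambda\hookrightarrow M$ in the space $C^0(\Lambda,M)$ (with the topology of uniform convergence) there is a neighbourhood $N$ of $f$ in the space $C^1(M,M)$ of all $C^1$-maps $M\to M$ (with the topology of uniform convergence on compact sets of maps and their differentials) such that for every $f'\in N$ there is an injective continuous map $h\in W$, $h\colon\Lambda\to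 M$, with $$f'\circ h=h\circ f \quad\text{on }\Lambda .$$ -/

import Mathlib

open Set Topology Bundle
open scoped Manifold ContDiff

noncomputable section

section HyperbolicSets

variable {E : Type*} [NormedAddCommGroup E] [NormedSpace ℝ E]
  {M : Type*} [TopologicalSpace M] [ChartedSpace E M] [IsManifold 𝓘(ℝ, E) ∞ M]

/-- The family `V` of subspaces `V x ⊆ T_x M` is, over `Λ`, a continuous subbundle of `TM|Λ`:
near every point of `Λ` it has a frame made of continuous sections over `Λ`. -/
def IsContinuousSubbundleOn (Λ : Set M)
    (V : ∀ x : M, Submodule ℝ (TangentSpace 𝓘(ℝ, E) x)) : Prop :=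
  ∀ x₀ ∈ Λ, ∃ U : Set M, IsOpen U ∧ x₀ ∈ U ∧
    ∃ (k : ℕ) (v : Fin k → ∀ x : M, TangentSpace 𝓘(ℝ, E) x),
      (∀ i, ContinuousOn (fun x ↦ (⟨x, v i x⟩ : TangentBundle 𝓘(ℝ, E) M)) (U ∩ Λ)) ∧
      ∀ x ∈ U ∩ Λ, LinearIndependent ℝ (fun i ↦ v i x) ∧
        Submodule.span ℝ (range fun i ↦ v i x) = V x

/-- The length of the tangent vector `v` at `x` for the continuous Riemannian metric `g`. -/
def tangentNorm (g : ContinuousRiemannianMetric E (fun x : M ↦ TangentSpace 𝓘(ℝ, E) x))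
    (x : M) (v : TangentSpace 𝓘(ℝ, E) x) : ℝ :=
  Real.sqrt (g.inner x v v)

/-- `Λ` is a compact, `f`-invariant, uniformly hyperbolic set of the `C¹`-diffeomorphism `f`:
`TM|Λ` is the direct sum of two continuous `Df`-invariant subbundles `Es`, `Eu`, the first one
uniformly contracted by the iterates of `f`, the second one by those of `f⁻¹`. The norms come
from a Riemannian metric on `M`; as `Λ` is compact, changing it only changes the constant `C`. -/
structure IsUniformlyHyperbolic (f : M ≃ₘ^1⟮𝓘(ℝ, E), 𝓘(ℝ, E)⟯ M) (Λ : Set M) : Prop where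
  isCompact : IsCompact Λ
  image_eq : f '' Λ = Λ
  exists_splitting :
    ∃ (g : ContinuousRiemannianMetric E (fun x : M ↦ TangentSpace 𝓘(ℝ, E) x))
      (Es Eu : ∀ x : M, Submodule ℝ (TangentSpace 𝓘(ℝ, E) x)),
      IsContinuousSubbundleOn Λ Es ∧ IsContinuousSubbundleOn Λ Eu ∧
      (∀ x ∈ Λ, IsCompl (Es x) (Eu x)) ∧
      (∀ x ∈ Λ, (Es x).map (mfderiv 𝓘(ℝ, E) 𝓘(ℝ, E) f x).toLinearMap = Es (f x)) ∧
      (∀ x ∈ Λ, (Eu x).map (mfderiv 𝓘(ℝ, E) 𝓘(ℝ, E) f x).toLinearMap = Eu (f x)) ∧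
      ∃ lam C : ℝ, 0 < lam ∧ lam < 1 ∧ 0 < C ∧ ∀ x ∈ Λ, ∀ n : ℕ,
        (∀ v ∈ Es x,
          tangentNorm g (f^[n] x) (mfderiv 𝓘(ℝ, E) 𝓘(ℝ, E) f^[n] x v) ≤
            C * lam ^ n * tangentNorm g x v) ∧
        (∀ v ∈ Eu x,
          tangentNorm g (f.symm^[n] x) (mfderiv 𝓘(ℝ, E) 𝓘(ℝ, E) f.symm^[n] x v) ≤
            C * lam ^ n * tangentNorm g x v)

/-- The tangent map `Tf : TM → TM` of a `C¹`-map `f : M → M`, as a continuous map. -/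
def continuousTangentMap (f : C^1⟮𝓘(ℝ, E), M; 𝓘(ℝ, E), M⟯) :
    C(TangentBundle 𝓘(ℝ, E) M, TangentBundle 𝓘(ℝ, E) M) where
  toFun := tangentMap 𝓘(ℝ, E) 𝓘(ℝ, E) f
  continuous_toFun := f.contMDiff.continuous_tangentMap le_rfl

/-- The (weak, i.e. compact-open) `C¹`-topology on the `C¹`-maps `M → M`: maps are close if they
and their differentials are uniformly close on compact sets. It is the coarsest topology for which
`f ↦ Tf` is continuous into the continuous maps `TM → TM` with the compact-open topology. -/
@[reducible] def weakC1Topology : TopologicalSpace C^1⟮𝓘(ℝ, E), M; 𝓘(ℝ, E), M⟯ :=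
  TopologicalSpace.induced continuousTangentMap inferInstance

/-- The inclusion `Λ → M`. -/
def inclusionMap (Λ : Set M) : C(Λ, M) := ⟨Subtype.val, continuous_subtype_val⟩

/-- The set `Λ`, left invariant by the `C¹`-map `f`, is structurally stable: every `C¹`-map `f'`
sufficiently `C¹`-close to `f` admits a continuous injection `h : Λ → M` with `f' ∘ h = h ∘ f`,
and `h` is as `C⁰`-close to the inclusion as one wishes, provided `f'` is close enough to `f`. -/
def IsStructurallyStable (f : C^1⟮𝓘(ℝ, E), M; 𝓘(ℝ, E), M⟯) (Λ : Set M) : Prop :=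
  ∃ hinv : MapsTo f Λ Λ, ∀ W ∈ 𝓝 (inclusionMap Λ), ∃ N ∈ @nhds _ weakC1Topology f,
    ∀ f' ∈ N, ∃ h ∈ W, Function.Injective h ∧ f' ∘ h = h ∘ hinv.restrict f Λ Λ

end HyperbolicSets

end

/-! The point `h x` is found through its whole `f'`-orbit: it should be the only orbit of `f'` that
stays close to the `f`-orbit of `x` for all times in `ℤ`.

Read in charts along the `f`-orbit, such an orbit is a bounded sequence of displacements with `v (n
+ 1) = φ n (v n)`, where `φ n` differs from the derivative `A n` of `f` by a map of small Lipschitz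
constant. Hyperbolicity makes the operator sending `v` to the sequence `v (n + 1) - A n (v n)`
invertible on bounded sequences: stable components are summed from the past, unstable ones from the
future (`exists_norm_le_of_isHyperbolicSequence`, `IsHyperbolicSequence.exists_bounded_solution`).
Banach's fixed point theorem then gives existence and uniqueness of the orbit
(`exists_unique_orbit_of_isHyperbolicSequence`). Since `Λ` is compact, finitely many charts suffice
and all constants are uniform over orbits, so one neighbourhood of `f` serves them all
(`IsUniformlyHyperbolic.exists_isShadowing`).

The rest is formal (`IsShadowing.exists_conjugacy`). Uniqueness gives equivariance and a closed
graph, hence continuity. If `h x = h x'`, the two shadowing orbits agree forward trivially and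
backward by local injectivity of `f'`; the `f`-orbits of `x` and `x'` then stay close to each other,
and the uniqueness statement for `f' = f`, which is expansivity, gives `x = x'`. -/

noncomputable section

open Filter Function Metric

/-! ### Hyperbolic sequences of linear operators and their perturbations. -/

section HyperbolicSequences

variable {E : Type*} [NormedAddCommGroup E] [NormedSpace ℝ E]

/-- The product `A (n + k - 1) ∘ ⋯ ∘ A n`. -/
def cocycle (A : ℤ → E →L[ℝ] E) (n : ℤ) : ℕ → E →L[ℝ] E
  | 0 => ContinuousLinearMap.id ℝ E
  | k + 1 => (A (n + k)).comp (cocycle A n k)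

/-- A bi-infinite sequence of operators with an invariant splitting into uniformly contracted and
uniformly expanded subspaces. -/
structure IsHyperbolicSequence (A : ℤ → E →L[ℝ] E) (S U : ℤ → Submodule ℝ E)
    (K C lam : ℝ) : Prop where
  norm_le : ∀ n, ‖A n‖ ≤ K
  exists_add : ∀ n w, ∃ s ∈ S n, ∃ u ∈ U n, s + u = w
  map_stable : ∀ n, ∀ v ∈ S n, A n v ∈ S (n + 1)
  map_unstable : ∀ n, ∀ v ∈ U n, A n v ∈ U (n + 1)
  surj_unstable : ∀ n, ∀ v ∈ U (n + 1), ∃ u ∈ U n, A n u = v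
  contract : ∀ n k, ∀ v ∈ S n, ‖cocycle A n k v‖ ≤ C * lam ^ k * ‖v‖
  expand : ∀ n k, ∀ v ∈ U n, ‖v‖ ≤ C * lam ^ k * ‖cocycle A n k v‖

variable {A : ℤ → E →L[ℝ] E} {S U : ℤ → Submodule ℝ E} {K C lam : ℝ}

lemma cocycle_zero (A : ℤ → E →L[ℝ] E) (n : ℤ) (v : E) : cocycle A n 0 v = v := rfl

lemma cocycle_succ (A : ℤ → E →L[ℝ] E) (n : ℤ) (k : ℕ) (v : E) :
    cocycle A n (k + 1) v = A (n + k) (cocycle A n k v) := rfl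

lemma cocycle_succ' (A : ℤ → E →L[ℝ] E) (n : ℤ) (k : ℕ) (v : E) :
    cocycle A n (k + 1) v = cocycle A (n + 1) k (A n v) := by
  induction k with
  | zero => simp [cocycle]
  | succ k ih =>
    rw [cocycle_succ, ih, cocycle_succ]
    congr 2
    push_cast; ring

namespace IsHyperbolicSequence

lemma K_nonneg (h : IsHyperbolicSequence A S U K C lam) : 0 ≤ K :=
  (norm_nonneg _).trans (h.norm_le 0)

lemma norm_cocycle_le (h : IsHyperbolicSequence A S U K C lam) (n : ℤ) (k : ℕ) (v : E) :
    ‖cocycle A n k v‖ ≤ K ^ k * ‖v‖ := by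
  induction k with
  | zero => simp [cocycle]
  | succ k ih =>
    rw [cocycle_succ]
    calc ‖A (n + k) (cocycle A n k v)‖ ≤ ‖A (n + k)‖ * ‖cocycle A n k v‖ :=
          ContinuousLinearMap.le_opNorm _ _
      _ ≤ K * (K ^ k * ‖v‖) := by gcongr; exacts [h.K_nonneg, h.norm_le _]
      _ = _ := by ring

lemma cocycle_mem_stable (h : IsHyperbolicSequence A S U K C lam) (n : ℤ) (k : ℕ) {v : E}
    (hv : v ∈ S n) : cocycle A n k v ∈ S (n + k) := by
  induction k with
  | zero => simpa [cocycle] using hv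
  | succ k ih =>
    have := h.map_stable _ _ ih
    rw [cocycle_succ]; convert this using 2; push_cast; ring

lemma cocycle_mem_unstable (h : IsHyperbolicSequence A S U K C lam) (n : ℤ) (k : ℕ) {v : E}
    (hv : v ∈ U n) : cocycle A n k v ∈ U (n + k) := by
  induction k with
  | zero => simpa [cocycle] using hv
  | succ k ih =>
    have := h.map_unstable _ _ ih
    rw [cocycle_succ]; convert this using 2; push_cast; ring

lemma exists_cocycle_eq (h : IsHyperbolicSequence A S U K C lam) (n : ℤ) (k : ℕ) {v : E}
    (hv : v ∈ U (n + k)) : ∃ u ∈ U n, cocycle A n k u = v := by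
  induction k generalizing v with
  | zero => exact ⟨v, by simpa using hv, rfl⟩
  | succ k ih =>
    obtain ⟨u, hu, rfl⟩ := h.surj_unstable (n + k) v (by convert hv using 2; push_cast; ring)
    obtain ⟨u', hu', rfl⟩ := ih hu
    exact ⟨u', hu', rfl⟩

lemma cocycle_injOn_unstable (h : IsHyperbolicSequence A S U K C lam) (n : ℤ) (k : ℕ) {u u' : E}
    (hu : u ∈ U n) (hu' : u' ∈ U n) (heq : cocycle A n k u = cocycle A n k u') : u = u' := by
  have := h.expand n k (u - u') ((U n).sub_mem hu hu')
  rw [map_sub, heq, sub_self, norm_zero, mul_zero] at this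
  exact sub_eq_zero.1 (norm_le_zero_iff.1 this)

end IsHyperbolicSequence

lemma exists_mul_pow_le_half (C : ℝ) (hlam : 0 < lam) (hlam1 : lam < 1) :
    ∃ N : ℕ, C * lam ^ N ≤ 1 / 2 := by
  have : Tendsto (fun N : ℕ ↦ C * lam ^ N) atTop (𝓝 (C * 0)) :=
    (tendsto_pow_atTop_nhds_zero_of_lt_one hlam.le hlam1).const_mul C
  rw [mul_zero] at this
  exact (this.eventually (ge_mem_nhds (by norm_num : (0 : ℝ) < 1 / 2))).exists

/-- The angle between the stable and unstable subspaces is bounded below by the constants of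
hyperbolicity. -/
lemma IsHyperbolicSequence.norm_stable_unstable_le (h : IsHyperbolicSequence A S U K C lam)
    {N : ℕ} (hN : C * lam ^ N ≤ 1 / 2) (n : ℤ) {s u : E}
    (hs : s ∈ S n) (hu : u ∈ U n) :
    ‖s‖ ≤ (K ^ N + 2) * ‖s + u‖ ∧ ‖u‖ ≤ (K ^ N + 2) * ‖s + u‖ := by
  have h1 := h.contract n N s hs
  have h2 := h.expand n N u hu
  have h3 := h.norm_cocycle_le n N (s + u)
  -- After `N` steps `u` has at least doubled and `s` at least halved, so a small `s + u` forces a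
  -- small `u`.
  have h4 : ‖cocycle A n N u‖ ≤ ‖cocycle A n N (s + u)‖ + ‖cocycle A n N s‖ := by
    have : cocycle A n N u = cocycle A n N (s + u) - cocycle A n N s := by
      rw [map_add]; abel
    rw [this]; exact norm_sub_le _ _
  have h5 : ‖s‖ ≤ ‖s + u‖ + ‖u‖ := by
    simpa using norm_sub_le (s + u) u
  have hKN : 0 ≤ K ^ N := pow_nonneg h.K_nonneg N
  have h6 : C * lam ^ N * ‖s‖ ≤ 1 / 2 * ‖s‖ := by gcongr
  have h7 : C * lam ^ N * ‖cocycle A n N u‖ ≤ 1 / 2 * ‖cocycle A n N u‖ := by gcongr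
  have h8 : 0 ≤ K ^ N * ‖s + u‖ := by positivity
  have h9 := norm_nonneg (s + u)
  constructor <;> nlinarith

/-- Bounded solutions of `v (n + 1) = A n (v n) + w n` are bounded in terms of `w`. -/
theorem exists_norm_le_of_isHyperbolicSequence (K C : ℝ) (hlam : 0 < lam)
    (hlam1 : lam < 1) :
    ∃ R > 0, ∀ {A : ℤ → E →L[ℝ] E} {S U : ℤ → Submodule ℝ E},
      IsHyperbolicSequence A S U K C lam → ∀ (v : ℤ → E) (V W : ℝ), (∀ n, ‖v n‖ ≤ V) →
      (∀ n, ‖v (n + 1) - A n (v n)‖ ≤ W) → ∀ n, ‖v n‖ ≤ R * W := by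
  obtain ⟨N, hN⟩ := exists_mul_pow_le_half C hlam hlam1
  by_cases hK : 0 ≤ K
  swap
  · exact ⟨1, one_pos, fun h ↦ (hK h.K_nonneg).elim⟩
  set c : ℝ := ∑ j ∈ Finset.range N, K ^ j
  have hc : 0 ≤ c := Finset.sum_nonneg fun j _ ↦ pow_nonneg hK j
  set B : ℝ := K ^ N + 2
  have hB : 0 < B := by positivity
  -- The stable and unstable components contribute `2 * (B * c)` each; the `1` keeps the constant
  -- positive when `N = 0`.
  refine ⟨4 * (B * c) + 1, by positivity, fun {A S U} h v V W hV hW ↦ ?_⟩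
  have hW0 : 0 ≤ W := (norm_nonneg _).trans (hW 0)
  have hiter : ∀ (n : ℤ) (k : ℕ),
      ‖v (n + k) - cocycle A n k (v n)‖ ≤ (∑ j ∈ Finset.range k, K ^ j) * W := by
    intro n k
    induction k with
    | zero => simp [cocycle]
    | succ k ih =>
      have e : v (n + (k + 1 : ℕ)) - cocycle A n (k + 1) (v n) =
          (v (n + k + 1) - A (n + k) (v (n + k))) +
            A (n + k) (v (n + k) - cocycle A n k (v n)) := by
        rw [cocycle_succ, map_sub]; push_cast; rw [← add_assoc]; abel
      rw [e, Finset.sum_range_succ']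
      calc _ ≤ W + K * ((∑ j ∈ Finset.range k, K ^ j) * W) := by
            refine (norm_add_le _ _).trans (add_le_add (hW _) ?_)
            refine (ContinuousLinearMap.le_opNorm _ _).trans ?_
            gcongr
            exact h.norm_le _
        _ = _ := by simp only [pow_succ, ← Finset.sum_mul]; ring
  choose s hs u hu hsu using fun n ↦ h.exists_add n (v n)
  have hdec : ∀ n, ‖s (n + N) - cocycle A n N (s n)‖ ≤ B * (c * W) ∧
      ‖u (n + N) - cocycle A n N (u n)‖ ≤ B * (c * W) := by
    intro n
    have h1 : s (n + N) - cocycle A n N (s n) ∈ S (n + N) :=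
      (S _).sub_mem (hs _) (h.cocycle_mem_stable n N (hs n))
    have h2 : u (n + N) - cocycle A n N (u n) ∈ U (n + N) :=
      (U _).sub_mem (hu _) (h.cocycle_mem_unstable n N (hu n))
    have e : s (n + N) - cocycle A n N (s n) + (u (n + N) - cocycle A n N (u n)) =
        v (n + N) - cocycle A n N (v n) := by
      rw [← hsu, ← hsu n, map_add]; abel
    have h3 := h.norm_stable_unstable_le hN _ h1 h2
    rw [e] at h3
    have h4 := hiter n N
    exact ⟨h3.1.trans (by gcongr), h3.2.trans (by gcongr)⟩
  have hbs : ∀ n, ‖s n‖ ≤ B * V := fun n ↦ by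
    have := (h.norm_stable_unstable_le hN n (hs n) (hu n)).1
    rw [hsu] at this
    exact this.trans (by gcongr; exact hV n)
  have hbu : ∀ n, ‖u n‖ ≤ B * V := fun n ↦ by
    have := (h.norm_stable_unstable_le hN n (hs n) (hu n)).2
    rw [hsu] at this
    exact this.trans (by gcongr; exact hV n)
  -- The a priori bound makes the supremum finite, so half of it can be absorbed. This is used with
  -- `σ` the shift by `-N` for the stable part and by `N` for the unstable part.
  have key : ∀ (a : ℤ → ℝ) (σ : ℤ → ℤ) (b D : ℝ), (∀ n, a n ≤ D) →
      (∀ n, a n ≤ 1 / 2 * a (σ n) + b) → ∀ n, a n ≤ 2 * b := by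
    intro a σ b D hD hb n
    have hbd : BddAbove (range a) := ⟨D, by rintro _ ⟨n, rfl⟩; exact hD n⟩
    have : ⨆ n, a n ≤ 1 / 2 * (⨆ n, a n) + b :=
      ciSup_le fun n ↦ (hb n).trans (by have := le_ciSup hbd (σ n); linarith)
    have := le_ciSup hbd n
    linarith
  have hS : ∀ n, ‖s n‖ ≤ 2 * (B * (c * W)) := by
    refine key (fun n ↦ ‖s n‖) (fun n ↦ n - N) _ _ hbs fun n ↦ ?_
    have h1 := (hdec (n - N)).1
    rw [sub_add_cancel] at h1
    have h2 := h.contract (n - N) N _ (hs _)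
    have h3 : C * lam ^ N * ‖s (n - N)‖ ≤ 1 / 2 * ‖s (n - N)‖ := by gcongr
    have h4 := norm_sub_norm_le (s n) (cocycle A (n - N) N (s (n - N)))
    linarith
  have hU : ∀ n, ‖u n‖ ≤ 2 * (B * (c * W)) := by
    refine key (fun n ↦ ‖u n‖) (fun n ↦ n + N) _ _ hbu fun n ↦ ?_
    have h1 := (hdec n).2
    have h2 := h.expand n N _ (hu n)
    have h3 : C * lam ^ N * ‖cocycle A n N (u n)‖ ≤ 1 / 2 * ‖cocycle A n N (u n)‖ := by gcongr
    have h4 := norm_sub_norm_le (cocycle A n N (u n)) (u (n + N))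
    rw [norm_sub_rev] at h4
    have h5 : 0 ≤ B * (c * W) := by positivity
    linarith
  intro n
  rw [← hsu n]
  have := norm_add_le (s n) (u n)
  have := hS n
  have := hU n
  nlinarith

/-- The inhomogeneous equation of a hyperbolic sequence of operators has a bounded solution for
every bounded right-hand side. -/
theorem IsHyperbolicSequence.exists_bounded_solution [CompleteSpace E]
    (h : IsHyperbolicSequence A S U K C lam) (hC : 0 < C) (hlam : 0 < lam) (hlam1 : lam < 1)
    (w : ℤ → E) (W : ℝ) (hw : ∀ n, ‖w n‖ ≤ W) :
    ∃ (v : ℤ → E) (V : ℝ), (∀ n, ‖v n‖ ≤ V) ∧ ∀ n, v (n + 1) = A n (v n) + w n := by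
  obtain ⟨N, hN⟩ := exists_mul_pow_le_half C hlam hlam1
  have hW0 : 0 ≤ W := (norm_nonneg _).trans (hw 0)
  have hK := h.K_nonneg
  -- The term `w (n - 1)` enters the equation at time `n`, so it is split along `S n` and `U n`.
  choose s hs u hu hsu using fun n ↦ h.exists_add n (w (n - 1))
  set B : ℝ := (K ^ N + 2) * W
  have hB : 0 ≤ B := by positivity
  have hbs : ∀ n, ‖s n‖ ≤ B := fun n ↦ by
    have := (h.norm_stable_unstable_le hN n (hs n) (hu n)).1
    rw [hsu] at this
    exact this.trans (mul_le_mul_of_nonneg_left (hw _) (by positivity))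
  have hbu : ∀ n, ‖u n‖ ≤ B := fun n ↦ by
    have := (h.norm_stable_unstable_le hN n (hs n) (hu n)).2
    rw [hsu] at this
    exact this.trans (mul_le_mul_of_nonneg_left (hw _) (by positivity))
  -- `b n k` is `u (n + k)` pulled back `k` steps inside the unstable subspaces, where the cocycle
  -- is injective.
  choose b hb hbeq using fun (n : ℤ) (k : ℕ) ↦ h.exists_cocycle_eq n k (hu (n + k))
  have hb0 : ∀ n, b n 0 = u n := fun n ↦ by
    have := hbeq n 0
    rw [cocycle_zero] at this
    simpa using this
  have hbsucc : ∀ n k, A n (b n (k + 1)) = b (n + 1) k := by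
    intro n k
    refine h.cocycle_injOn_unstable (n + 1) k (h.map_unstable _ _ (hb _ _)) (hb _ _) ?_
    rw [← cocycle_succ', hbeq, hbeq]
    congr 1; push_cast; ring
  set a : ℤ → ℕ → E := fun n k ↦ cocycle A (n - k) k (s (n - k))
  have hasucc : ∀ n k, A n (a n k) = a (n + 1) (k + 1) := by
    intro n k
    simp only [a]
    rw [cocycle_succ]
    have e : n + 1 - ((k + 1 : ℕ) : ℤ) = n - k := by push_cast; ring
    rw [e]; congr 1; simp
  have hgeo : Summable fun k : ℕ ↦ C * B * lam ^ k :=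
    (summable_geometric_of_lt_one hlam.le hlam1).mul_left _
  have ha_le : ∀ n k, ‖a n k‖ ≤ C * B * lam ^ k := fun n k ↦ by
    refine (h.contract _ k _ (hs _)).trans ?_
    calc C * lam ^ k * ‖s (n - k)‖ ≤ C * lam ^ k * B := by gcongr; exact hbs _
      _ = _ := by ring
  have hb_le : ∀ n k, ‖b n k‖ ≤ C * B * lam ^ k := fun n k ↦ by
    refine (h.expand _ k _ (hb n k)).trans ?_
    rw [hbeq]
    calc C * lam ^ k * ‖u (n + k)‖ ≤ C * lam ^ k * B := by gcongr; exact hbu _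
      _ = _ := by ring
  have hsa : ∀ n, Summable (a n) := fun n ↦ hgeo.of_norm_bounded (ha_le n)
  have hsb : ∀ n, Summable (b n) := fun n ↦ hgeo.of_norm_bounded (hb_le n)
  have hsb' : ∀ n, Summable fun k ↦ b n (k + 1) := fun n ↦ (summable_nat_add_iff 1).2 (hsb n)
  -- Past stable parts are pushed forward, future unstable parts pulled back with a minus sign. The
  -- unstable sum starts at `k = 1`: applying `A n` produces the `k = 0` term at time `n + 1`, which
  -- is cancelled by `u (n + 1)`.
  refine ⟨fun n ↦ ∑' k, a n k - (∑' k, b n k - b n 0),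
    C * B * (1 - lam)⁻¹ + (C * B * (1 - lam)⁻¹ + B), fun n ↦ ?_, fun n ↦ ?_⟩
  · have hg : HasSum (fun k : ℕ ↦ C * B * lam ^ k) (C * B * (1 - lam)⁻¹) :=
      (hasSum_geometric_of_lt_one hlam.le hlam1).mul_left _
    have h1 := tsum_of_norm_bounded hg (ha_le n)
    have h2 := tsum_of_norm_bounded hg (hb_le n)
    have h3 : ‖b n 0‖ ≤ B := by rw [hb0]; exact hbu n
    exact (norm_sub_le _ _).trans (add_le_add h1 ((norm_sub_le _ _).trans (add_le_add h2 h3)))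
  · have e1 : ∑' k, a (n + 1) k = s (n + 1) + A n (∑' k, a n k) := by
      rw [(hsa (n + 1)).tsum_eq_zero_add, (A n).map_tsum (hsa n)]
      simp only [hasucc]
      congr 1
      simp [a, cocycle]
    have e2 : ∑' k, b (n + 1) k = A n (∑' k, b n k - b n 0) := by
      rw [(hsb n).tsum_eq_zero_add, add_sub_cancel_left, (A n).map_tsum (hsb' n)]
      simp only [hbsucc]
    have e3 : s (n + 1) + u (n + 1) = w n := by simpa using hsu (n + 1)
    show ∑' k, a (n + 1) k - (∑' k, b (n + 1) k - b (n + 1) 0) = _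
    rw [e1, e2, hb0 (n + 1), ← e3]
    simp only [map_sub]
    abel

/-- Orbits of small Lipschitz perturbations of a hyperbolic sequence of operators: there is one in
a small ball, and at most one in any ball on which the perturbation is controlled. -/
theorem exists_unique_orbit_of_isHyperbolicSequence [CompleteSpace E] (K : ℝ) (hC : 0 < C)
    (hlam : 0 < lam) (hlam1 : lam < 1) :
    ∃ R > 0, ∀ {A : ℤ → E →L[ℝ] E} {S U : ℤ → Submodule ℝ E},
      IsHyperbolicSequence A S U K C lam → ∀ (φ : ℤ → E → E) (δ ε : ℝ), R * ε ≤ 1 / 2 →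
      (∀ n, ∀ p ∈ closedBall (0 : E) δ, ∀ q ∈ closedBall (0 : E) δ,
        ‖φ n p - φ n q - A n (p - q)‖ ≤ ε * ‖p - q‖) →
      (∀ v v' : ℤ → E, (∀ n, ‖v n‖ ≤ δ) → (∀ n, ‖v' n‖ ≤ δ) → (∀ n, v (n + 1) = φ n (v n)) →
        (∀ n, v' (n + 1) = φ n (v' n)) → v = v') ∧
      ∀ η, (∀ n, ‖φ n 0‖ ≤ η) → 2 * R * η ≤ δ →
        ∃ v : ℤ → E, (∀ n, ‖v n‖ ≤ 2 * R * η) ∧ ∀ n, v (n + 1) = φ n (v n) := by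
  obtain ⟨R, hR, hRb⟩ := exists_norm_le_of_isHyperbolicSequence (E := E) K C hlam hlam1
  refine ⟨R, hR, fun {A S U} h φ δ ε hε hφ ↦ ⟨fun v v' hv hv' hvo hvo' ↦ ?_, fun η hη hδ ↦ ?_⟩⟩
  · have hbd : ∀ n, ‖v n - v' n‖ ≤ δ + δ := fun n ↦
      (norm_sub_le _ _).trans (add_le_add (hv n) (hv' n))
    -- The linear bound applied to the difference gives `D ≤ D / 2`. As `ε` carries no sign, it is
    -- replaced by `max ε 0`.
    set D := ⨆ n, ‖v n - v' n‖
    have hD : ∀ n, ‖v n - v' n‖ ≤ D := fun n ↦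
      le_ciSup (f := fun n ↦ ‖v n - v' n‖) ⟨δ + δ, by rintro _ ⟨n, rfl⟩; exact hbd n⟩ n
    have hD0 : 0 ≤ D := (norm_nonneg _).trans (hD 0)
    have h1 : ∀ n, ‖(v - v') n‖ ≤ R * (max ε 0 * D) := by
      refine hRb h (v - v') D _ hD fun n ↦ ?_
      have := hφ n (v n) (by simpa using hv n) (v' n) (by simpa using hv' n)
      rw [← hvo, ← hvo'] at this
      refine this.trans ?_
      gcongr
      exacts [le_max_left _ _, hD n]
    have h2 : R * max ε 0 ≤ 1 / 2 := by
      rcases max_cases ε 0 with ⟨e, _⟩ | ⟨e, _⟩ <;> rw [e]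
      · exact hε
      · norm_num
    have h3 : D ≤ R * (max ε 0 * D) := ciSup_le h1
    have h4 : D = 0 := by nlinarith
    funext n
    have := hD n
    rw [h4] at this
    exact sub_eq_zero.1 (norm_le_zero_iff.1 this)
  · set r := 2 * R * η
    have hη0 : 0 ≤ η := (norm_nonneg _).trans (hη 0)
    have hr0 : 0 ≤ r := by positivity
    set ε' := max ε 0
    have hε0 : 0 ≤ ε' := le_max_right _ _
    have hε' : R * ε' ≤ 1 / 2 := by
      rcases max_cases ε 0 with ⟨e, _⟩ | ⟨e, _⟩ <;> simp only [ε', e]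
      · exact hε
      · norm_num
    have hφ' : ∀ n, ∀ p ∈ closedBall (0 : E) r, ∀ q ∈ closedBall (0 : E) r,
        ‖φ n p - φ n q - A n (p - q)‖ ≤ ε' * ‖p - q‖ := fun n p hp q hq ↦
      (hφ n p (closedBall_subset_closedBall hδ hp) q (closedBall_subset_closedBall hδ hq)).trans
        (by gcongr; exact le_max_left _ _)
    have hsmall : ∀ n, ∀ p ∈ closedBall (0 : E) r, ‖φ n p - A n p‖ ≤ 2 * η := by
      intro n p hp
      have h1 := hφ' n p hp 0 (by simpa using hr0)
      rw [sub_zero] at h1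
      have h2 : φ n p - A n p = (φ n p - φ n 0 - A n p) + φ n 0 := by abel
      have h3 : ‖p‖ ≤ r := by simpa using hp
      rw [h2]
      refine (norm_add_le _ _).trans ?_
      have h4 : ε' * ‖p‖ ≤ ε' * r := by gcongr
      have h5 : ε' * r ≤ η := by
        have : ε' * r = (R * ε') * (2 * η) := by simp only [r]; ring
        rw [this]; nlinarith
      linarith [hη n]
    let X := closedBall (0 : BoundedContinuousFunction ℤ E) r
    have hX : ∀ (x : X) n, x.1 n ∈ closedBall (0 : E) r := fun x n ↦ by
      have h1 : ‖x.1‖ ≤ r := mem_closedBall_zero_iff.1 x.2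
      simpa using (x.1.norm_coe_le_norm n).trans h1
    -- Freeze the nonlinear part at `x` and solve the linear equation for `y`; orbits of `φ` are the
    -- fixed points. The bound `2 * η` on the frozen part keeps `y` in the ball of radius `r = 2 * R
    -- * η`.
    have hT : ∀ x : X, ∃ y : X, ∀ n, y.1 (n + 1) = A n (y.1 n) + (φ n (x.1 n) - A n (x.1 n)) := by
      intro x
      obtain ⟨v, V, hV, hv⟩ := h.exists_bounded_solution hC hlam hlam1
        (fun n ↦ φ n (x.1 n) - A n (x.1 n)) (2 * η) fun n ↦ hsmall n _ (hX x n)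
      have hvr : ∀ n, ‖v n‖ ≤ r := fun n ↦ by
        have := hRb h v V (2 * η) hV (fun n ↦ by
          rw [hv, add_sub_cancel_left]; exact hsmall n _ (hX x n)) n
        calc _ ≤ _ := this
          _ = r := by simp only [r]; ring
      refine ⟨⟨BoundedContinuousFunction.ofNormedAddCommGroup v continuous_of_discreteTopology
        r hvr, ?_⟩, fun n ↦ hv n⟩
      exact mem_closedBall_zero_iff.2 (BoundedContinuousFunction.norm_ofNormedAddCommGroup_le _ hr0 hvr)
    choose T hT using hT
    have hTc : ContractingWith (1 / 2) T := by
      refine ⟨by norm_num, LipschitzWith.of_dist_le_mul fun x y ↦ ?_⟩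
      have h1 : ∀ n, ‖((T x).1 - (T y).1) n‖ ≤ R * (ε' * dist x y) := by
        refine hRb h _ ‖(T x).1 - (T y).1‖ _
          (BoundedContinuousFunction.norm_coe_le_norm _) fun n ↦ ?_
        have e : ((T x).1 - (T y).1) (n + 1) - A n (((T x).1 - (T y).1) n) =
            φ n (x.1 n) - φ n (y.1 n) - A n (x.1 n - y.1 n) := by
          simp only [BoundedContinuousFunction.coe_sub, Pi.sub_apply, hT, map_sub]
          abel
        rw [e]
        refine (hφ' n _ (hX x n) _ (hX y n)).trans ?_
        gcongr
        rw [← dist_eq_norm]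
        exact BoundedContinuousFunction.dist_coe_le_dist n
      rw [Subtype.dist_eq, dist_eq_norm, NNReal.coe_div, NNReal.coe_one, NNReal.coe_ofNat]
      rw [BoundedContinuousFunction.norm_le (by positivity)]
      intro n
      refine (h1 n).trans ?_
      rw [← mul_assoc]
      gcongr
    have : CompleteSpace X := isClosed_closedBall.completeSpace_coe
    have : Nonempty X := ⟨⟨0, by simpa [X] using hr0⟩⟩
    set x := hTc.fixedPoint T
    have hx : T x = x := hTc.fixedPoint_isFixedPt
    refine ⟨fun n ↦ x.1 n, fun n ↦ by simpa using hX x n, fun n ↦ ?_⟩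
    have := hT x n
    rw [hx] at this
    show x.1 (n + 1) = _
    rw [this]; abel

end HyperbolicSequences

/-! ### Maps read in charts, and the `C¹`-topology in coordinates. -/

section LocalRepresentatives

variable {E : Type*} [NormedAddCommGroup E]
  {M : Type*} [TopologicalSpace M] [ChartedSpace E M]

/-- The map `f` read in the charts at `i` and `j`. -/
def localRep (f : M → M) (i j : M) (q : E) : E := chartAt E j (f ((chartAt E i).symm q))

/-- The set on which `localRep f i j` represents `f`. -/
def localDom (E : Type*) [NormedAddCommGroup E] {M : Type*} [TopologicalSpace M] [ChartedSpace E M]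
    (f : M → M) (i j : M) : Set E :=
  (chartAt E i).target ∩ (chartAt E i).symm ⁻¹' (f ⁻¹' (chartAt E j).source)

lemma isOpen_localDom {f : M → M} (hf : Continuous f) (i j : M) : IsOpen (localDom E f i j) :=
  (chartAt E i).isOpen_inter_preimage_symm ((chartAt E j).open_source.preimage hf)

lemma chartAt_mem_localDom {f : M → M} {i j x : M} (hx : x ∈ (chartAt E i).source)
    (hfx : f x ∈ (chartAt E j).source) : chartAt E i x ∈ localDom E f i j :=
  ⟨(chartAt E i).map_source hx, by simpa [(chartAt E i).left_inv hx] using hfx⟩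

lemma localRep_chartAt (f : M → M) {i x : M} (j : M) (hx : x ∈ (chartAt E i).source) :
    localRep f i j (chartAt E i x) = chartAt E j (f x) := by
  simp [localRep, (chartAt E i).left_inv hx]

variable [NormedSpace ℝ E] [IsManifold 𝓘(ℝ, E) ∞ M]

lemma contDiffOn_localRep {f : M → M} (hf : ContMDiff 𝓘(ℝ, E) 𝓘(ℝ, E) 1 f) (i j : M) :
    ContDiffOn ℝ 1 (localRep f i j) (localDom E f i j) := by
  rw [← contMDiffOn_iff_contDiffOn]
  have h1 : ContMDiffOn 𝓘(ℝ, E) 𝓘(ℝ, E) 1 (chartAt E i).symm (chartAt E i).target :=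
    (contMDiffOn_chart_symm (n := ∞)).of_le (by exact_mod_cast le_top)
  have h2 : ContMDiffOn 𝓘(ℝ, E) 𝓘(ℝ, E) 1 (chartAt E j) (chartAt E j).source :=
    (contMDiffOn_chart (n := ∞)).of_le (by exact_mod_cast le_top)
  exact h2.comp ((hf.comp_contMDiffOn h1).mono inter_subset_left) fun q hq ↦ hq.2

lemma differentiableAt_localRep {f : M → M} (hf : ContMDiff 𝓘(ℝ, E) 𝓘(ℝ, E) 1 f) {i j : M} {q : E}
    (hq : q ∈ localDom E f i j) : DifferentiableAt ℝ (localRep f i j) q :=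
  ((contDiffOn_localRep hf i j).differentiableOn one_ne_zero).differentiableAt
    ((isOpen_localDom hf.continuous i j).mem_nhds hq)

lemma fderiv_localRep {f : M → M} (hf : ContMDiff 𝓘(ℝ, E) 𝓘(ℝ, E) 1 f) {i j : M} {q : E}
    (hq : q ∈ localDom E f i j) (w : E) :
    fderiv ℝ (localRep f i j) q w =
      mfderiv 𝓘(ℝ, E) 𝓘(ℝ, E) (chartAt E j) (f ((chartAt E i).symm q))
        (mfderiv 𝓘(ℝ, E) 𝓘(ℝ, E) f ((chartAt E i).symm q)
          (mfderiv 𝓘(ℝ, E) 𝓘(ℝ, E) (chartAt E i).symm q w)) := by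
  have : IsManifold 𝓘(ℝ, E) 1 M := .of_le (n := ∞) (by exact_mod_cast le_top)
  have h1 : MDifferentiableAt 𝓘(ℝ, E) 𝓘(ℝ, E) (chartAt E i).symm q :=
    (mdifferentiable_chart i).mdifferentiableAt_symm hq.1
  have h2 : MDifferentiableAt 𝓘(ℝ, E) 𝓘(ℝ, E) f ((chartAt E i).symm q) :=
    hf.mdifferentiableAt one_ne_zero
  have h3 : MDifferentiableAt 𝓘(ℝ, E) 𝓘(ℝ, E) (chartAt E j) (f ((chartAt E i).symm q)) :=
    (mdifferentiable_chart j).mdifferentiableAt hq.2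
  have e : localRep f i j = chartAt E j ∘ f ∘ (chartAt E i).symm := rfl
  rw [← mfderiv_eq_fderiv, e, mfderiv_comp q h3 (h2.comp q h1), mfderiv_comp q h2 h1]
  rfl

lemma fderiv_localRep_chartAt {f : M → M} (hf : ContMDiff 𝓘(ℝ, E) 𝓘(ℝ, E) 1 f) {i j x : M}
    (hx : x ∈ (chartAt E i).source) (hfx : f x ∈ (chartAt E j).source)
    (v : TangentSpace 𝓘(ℝ, E) x) :
    fderiv ℝ (localRep f i j) (chartAt E i x) (mfderiv 𝓘(ℝ, E) 𝓘(ℝ, E) (chartAt E i) x v) =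
      mfderiv 𝓘(ℝ, E) 𝓘(ℝ, E) (chartAt E j) (f x) (mfderiv 𝓘(ℝ, E) 𝓘(ℝ, E) f x v) := by
  have : IsManifold 𝓘(ℝ, E) 1 M := .of_le (n := ∞) (by exact_mod_cast le_top)
  have h1 : MDifferentiableAt 𝓘(ℝ, E) 𝓘(ℝ, E) (chartAt E i) x :=
    (mdifferentiable_chart i).mdifferentiableAt hx
  have h2 : MDifferentiableAt 𝓘(ℝ, E) 𝓘(ℝ, E) f x := hf.mdifferentiableAt one_ne_zero
  have h3 : MDifferentiableAt 𝓘(ℝ, E) 𝓘(ℝ, E) (chartAt E j) (f x) :=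
    (mdifferentiable_chart j).mdifferentiableAt hfx
  have h4 : MDifferentiableAt 𝓘(ℝ, E) 𝓘(ℝ, E) (localRep f i j) (chartAt E i x) :=
    (differentiableAt_localRep hf (chartAt_mem_localDom hx hfx)).mdifferentiableAt
  have e : localRep f i j ∘ chartAt E i =ᶠ[𝓝 x] chartAt E j ∘ f := by
    filter_upwards [(chartAt E i).open_source.mem_nhds hx] with y hy
    exact localRep_chartAt f j hy
  have := e.mfderiv_eq (I := 𝓘(ℝ, E)) (I' := 𝓘(ℝ, E))
  rw [mfderiv_comp x h4 h1, mfderiv_comp x h3 h2, mfderiv_eq_fderiv] at this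
  exact DFunLike.congr_fun this v

/-- Maps that are close in the `C¹`-topology have close local representatives. -/
theorem eventually_localRep_close [FiniteDimensional ℝ E] (f : C^1⟮𝓘(ℝ, E), M; 𝓘(ℝ, E), M⟯)
    (i j : M) {Q : Set E} (hQ : IsCompact Q) (hQd : Q ⊆ localDom E f i j) {ε : ℝ} (hε : 0 < ε) :
    ∀ᶠ f' : C^1⟮𝓘(ℝ, E), M; 𝓘(ℝ, E), M⟯ in @nhds _ weakC1Topology f, ∀ q ∈ Q,
      q ∈ localDom E f' i j ∧ ‖localRep f' i j q - localRep f i j q‖ ≤ ε ∧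
        ‖fderiv ℝ (localRep f' i j) q - fderiv ℝ (localRep f i j) q‖ ≤ ε := by
  have : IsManifold 𝓘(ℝ, E) 1 M := .of_le (n := ∞) (by exact_mod_cast le_top)
  have : LocallyCompactSpace (TangentBundle 𝓘(ℝ, E) M) :=
    Manifold.locallyCompact_of_finiteDimensional (𝓘(ℝ, E).tangent)
  let σ : E × E → TangentBundle 𝓘(ℝ, E) M := fun p ↦
    ⟨(chartAt E i).symm p.1, mfderiv 𝓘(ℝ, E) 𝓘(ℝ, E) (chartAt E i).symm p.1 p.2⟩
  let τ : TangentBundle 𝓘(ℝ, E) M → E × E := fun z ↦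
    (chartAt E j z.1, mfderiv 𝓘(ℝ, E) 𝓘(ℝ, E) (chartAt E j) z.1 z.2)
  have hσ : ContinuousOn σ ((chartAt E i).target ×ˢ univ) := by
    have h1 : ContMDiffOn 𝓘(ℝ, E) 𝓘(ℝ, E) 1 (chartAt E i).symm (chartAt E i).target :=
      (contMDiffOn_chart_symm (n := ∞)).of_le (by exact_mod_cast le_top)
    have h2 := h1.continuousOn_tangentMapWithin le_rfl (chartAt E i).open_target.uniqueMDiffOn
    have h3 : ContinuousOn (tangentMap 𝓘(ℝ, E) 𝓘(ℝ, E) (chartAt E i).symm)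
        (TotalSpace.proj ⁻¹' (chartAt E i).target) :=
      h2.congr fun z hz ↦ (tangentMapWithin_eq_tangentMap
        ((chartAt E i).open_target.uniqueMDiffOn _ hz)
        ((mdifferentiable_chart i).mdifferentiableAt_symm hz)).symm
    have h4 : Continuous fun p : E × E ↦ (⟨p.1, p.2⟩ : TangentBundle 𝓘(ℝ, E) E) :=
      (tangentBundleModelSpaceHomeomorph 𝓘(ℝ, E)).symm.continuous
    exact h3.comp h4.continuousOn fun p hp ↦ hp.1
  have hτ : ContinuousOn τ (TotalSpace.proj ⁻¹' (chartAt E j).source) := by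
    have h1 : ContMDiffOn 𝓘(ℝ, E) 𝓘(ℝ, E) 1 (chartAt E j) (chartAt E j).source :=
      (contMDiffOn_chart (n := ∞)).of_le (by exact_mod_cast le_top)
    have h2 := h1.continuousOn_tangentMapWithin le_rfl (chartAt E j).open_source.uniqueMDiffOn
    have h3 : ContinuousOn (tangentMap 𝓘(ℝ, E) 𝓘(ℝ, E) (chartAt E j))
        (TotalSpace.proj ⁻¹' (chartAt E j).source) :=
      h2.congr fun z hz ↦ (tangentMapWithin_eq_tangentMap
        ((chartAt E j).open_source.uniqueMDiffOn _ hz)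
        ((mdifferentiable_chart j).mdifferentiableAt hz)).symm
    exact (tangentBundleModelSpaceHomeomorph 𝓘(ℝ, E)).continuous.comp_continuousOn h3
  have hV : IsOpen (TotalSpace.proj ⁻¹' (chartAt E j).source : Set (TangentBundle 𝓘(ℝ, E) M)) :=
    (chartAt E j).open_source.preimage (FiberBundle.continuous_proj E (TangentSpace 𝓘(ℝ, E)))
  set V : Set (TangentBundle 𝓘(ℝ, E) M) := TotalSpace.proj ⁻¹' (chartAt E j).source
  -- Pairing `Tf` with `Tf'` turns closeness in the chart at `j` into one open condition on the
  -- pair, tested on the compact set of vectors over `Q` of coordinate norm at most `1`.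
  let O : Set (TangentBundle 𝓘(ℝ, E) M × TangentBundle 𝓘(ℝ, E) M) :=
    (V ×ˢ V) ∩ (fun z ↦ dist (τ z.2) (τ z.1)) ⁻¹' Iio ε
  have hO : IsOpen O := by
    refine ContinuousOn.isOpen_inter_preimage ?_ (hV.prod hV) isOpen_Iio
    exact continuous_dist.comp_continuousOn <|
      (hτ.comp (s := V ×ˢ V) continuousOn_snd fun z hz ↦ hz.2).prodMk
      (hτ.comp (s := V ×ˢ V) continuousOn_fst fun z hz ↦ hz.1)
  have hK : IsCompact (σ '' (Q ×ˢ closedBall 0 1)) :=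
    (hQ.prod (isCompact_closedBall _ _)).image_of_continuousOn
      (hσ.mono (prod_mono (hQd.trans inter_subset_left) (subset_univ _)))
  let G : C(TangentBundle 𝓘(ℝ, E) M, TangentBundle 𝓘(ℝ, E) M) →
      C(TangentBundle 𝓘(ℝ, E) M, TangentBundle 𝓘(ℝ, E) M × TangentBundle 𝓘(ℝ, E) M) :=
    fun g ↦ (continuousTangentMap f).prodMk g
  have hG : Continuous G := by
    refine ContinuousMap.continuous_of_continuous_uncurry _ ?_
    exact ((continuousTangentMap f).continuous.comp continuous_snd).prodMk
      (continuous_eval)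
  have hG0 : MapsTo (G (continuousTangentMap f)) (σ '' (Q ×ˢ closedBall 0 1)) O := by
    rintro _ ⟨⟨q, w⟩, ⟨hq, -⟩, rfl⟩
    exact ⟨⟨(hQd hq).2, (hQd hq).2⟩, by simpa [G] using hε⟩
  have key := hG.continuousAt.eventually (ContinuousMap.eventually_mapsTo hK hO hG0)
  let _ : TopologicalSpace C^1⟮𝓘(ℝ, E), M; 𝓘(ℝ, E), M⟯ := weakC1Topology
  have hT : Continuous (continuousTangentMap (E := E) (M := M)) := continuous_induced_dom
  filter_upwards [hT.continuousAt.eventually key] with f' hf' q hq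
  have hmem : ∀ w ∈ closedBall (0 : E) 1, G (continuousTangentMap f') (σ (q, w)) ∈ O :=
    fun w hw ↦ hf' (mem_image_of_mem _ ⟨hq, hw⟩)
  have hd : ∀ w ∈ closedBall (0 : E) 1,
      dist (τ (continuousTangentMap f' (σ (q, w)))) (τ (continuousTangentMap f (σ (q, w)))) < ε :=
    fun w hw ↦ (hmem w hw).2
  have hq' : q ∈ localDom E f' i j := ⟨(hQd hq).1, (hmem 0 (by simp)).1.2⟩
  refine ⟨hq', ?_, ?_⟩
  · rw [← dist_eq_norm]
    exact ((le_max_left _ _).trans_lt (hd 0 (by simp))).le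
  · refine ContinuousLinearMap.opNorm_le_of_unit_norm hε.le fun w hw ↦ ?_
    have h1 := ((le_max_right _ _).trans_lt (hd w (by simp [hw]))).le
    rw [dist_eq_norm] at h1
    rw [sub_apply, fderiv_localRep f'.contMDiff hq', fderiv_localRep f.contMDiff (hQd hq)]
    exact h1

end LocalRepresentatives

/-! ### Uniform linear approximation near compact sets. -/

section Uniform

/-- Near a compact subset of its domain, a `C¹`-map is uniformly close to its linear parts. -/
lemma eventually_norm_fderiv_sub_le {E F : Type*} [NormedAddCommGroup E] [NormedSpace ℝ E]
    [NormedAddCommGroup F] [NormedSpace ℝ F] {φ : E → F} {U K : Set E}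
    (hU : IsOpen U) (hφ : ContDiffOn ℝ 1 φ U) (hK : IsCompact K) (hKU : K ⊆ U) {ε : ℝ}
    (hε : 0 < ε) :
    ∀ᶠ δ in 𝓝[>] (0 : ℝ), cthickening δ K ⊆ U ∧
      ∀ p ∈ K, ∀ q ∈ closedBall p δ, ‖fderiv ℝ φ q - fderiv ℝ φ p‖ ≤ ε := by
  obtain ⟨δ₁, hδ₁, h1⟩ := hK.exists_cthickening_subset_open hU hKU
  have h2 := hK.uniformContinuousAt_of_continuousAt (fderiv ℝ φ)
    (fun a ha ↦ (hφ.continuousOn_fderiv_of_isOpen hU le_rfl).continuousAt (hU.mem_nhds (hKU ha)))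
    (Metric.dist_mem_uniformity hε)
  obtain ⟨δ₂, hδ₂, h2⟩ := Metric.mem_uniformity_dist.1 h2
  filter_upwards [Ioo_mem_nhdsGT (lt_min hδ₁ hδ₂)] with δ hδ
  refine ⟨(cthickening_mono (hδ.2.le.trans (min_le_left _ _)) _).trans h1, fun p hp q hq ↦ ?_⟩
  have : dist p q < δ₂ := by
    rw [dist_comm]
    exact (mem_closedBall.1 hq).trans_lt (hδ.2.trans_le (min_le_right _ _))
  have := h2 this hp
  rw [← dist_eq_norm, dist_comm]
  exact this.le

end Uniform

/-! ### Riemannian lengths compared with norms in charts. -/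

section TangentNorm

variable {E : Type*} [NormedAddCommGroup E] [NormedSpace ℝ E]
  {M : Type*} [TopologicalSpace M] [ChartedSpace E M] [IsManifold 𝓘(ℝ, E) ∞ M]

lemma tangentNorm_nonneg (g : ContinuousRiemannianMetric E (fun x : M ↦ TangentSpace 𝓘(ℝ, E) x))
    (x : M) (v : TangentSpace 𝓘(ℝ, E) x) : 0 ≤ tangentNorm g x v :=
  Real.sqrt_nonneg _

/-- The derivative at `x` of the chart at `i`. -/
def chartDeriv (i x : M) : TangentSpace 𝓘(ℝ, E) x →L[ℝ] E :=
  mfderiv 𝓘(ℝ, E) 𝓘(ℝ, E) (chartAt E i) x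

/-- The derivative of the chart at `i` distorts lengths at `x` at most by the factor `a`. -/
def ChartDistortionLE (g : ContinuousRiemannianMetric E (fun x : M ↦ TangentSpace 𝓘(ℝ, E) x))
    (a : ℝ) (i x : M) : Prop :=
  ∀ v : TangentSpace 𝓘(ℝ, E) x,
    ‖chartDeriv i x v‖ ≤ a * tangentNorm g x v ∧ tangentNorm g x v ≤ a * ‖chartDeriv i x v‖

lemma ChartDistortionLE.mono
    {g : ContinuousRiemannianMetric E (fun x : M ↦ TangentSpace 𝓘(ℝ, E) x)} {a b : ℝ} {i x : M}
    (h : ChartDistortionLE g a i x) (hab : a ≤ b) : ChartDistortionLE g b i x := fun v ↦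
  ⟨(h v).1.trans (mul_le_mul_of_nonneg_right hab (tangentNorm_nonneg g x v)),
    (h v).2.trans (mul_le_mul_of_nonneg_right hab (norm_nonneg _))⟩

/-- Over the chart source the trivialization of the tangent bundle at `i` is the derivative of the
chart, and a continuous metric bounds it and its inverse near `i`. -/
lemma eventually_chartDistortionLE
    (g : ContinuousRiemannianMetric E (fun x : M ↦ TangentSpace 𝓘(ℝ, E) x)) (i : M) :
    ∃ a, ∀ᶠ x in 𝓝 i, ChartDistortionLE g a i x := by
  have : IsManifold 𝓘(ℝ, E) 1 M := .of_le (n := ∞) (by exact_mod_cast le_top)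
  let _ : RiemannianBundle (fun x : M ↦ TangentSpace 𝓘(ℝ, E) x) := ⟨g.toRiemannianMetric⟩
  obtain ⟨a, ha, h1⟩ := eventually_norm_trivializationAt_lt E
    (fun x : M ↦ TangentSpace 𝓘(ℝ, E) x) i
  obtain ⟨b, hb, h2⟩ := eventually_norm_symmL_trivializationAt_lt E
    (fun x : M ↦ TangentSpace 𝓘(ℝ, E) x) i
  refine ⟨max a b, ?_⟩
  filter_upwards [h1, h2, (chartAt E i).open_source.mem_nhds (mem_chart_source E i)]
    with x hx1 hx2 hx v
  have hn : tangentNorm g x v = ‖v‖ := rfl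
  have he : (trivializationAt E (TangentSpace 𝓘(ℝ, E)) i).continuousLinearMapAt ℝ x v =
      chartDeriv i x v := by
    rw [TangentBundle.continuousLinearMapAt_trivializationAt hx]
    simp [extChartAt, mfld_simps]
    rfl
  rw [hn, ← he]
  constructor
  · refine (ContinuousLinearMap.le_opNorm _ _).trans ?_
    gcongr
    exact hx1.le.trans (le_max_left _ _)
  · have hs := (trivializationAt E (TangentSpace 𝓘(ℝ, E)) i).symmL_continuousLinearMapAt (R := ℝ)
      (b := x) (by simpa using hx) v
    conv_lhs => rw [← hs]
    refine (ContinuousLinearMap.le_opNorm _ _).trans ?_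
    gcongr
    exact hx2.le.trans (le_max_right _ _)

/-- A compact set is covered by finitely many compact pieces of charts, on which the charts have
bounded distortion. -/
lemma exists_chart_cover [LocallyCompactSpace M]
    (g : ContinuousRiemannianMetric E (fun x : M ↦ TangentSpace 𝓘(ℝ, E) x)) {Λ : Set M}
    (hΛ : IsCompact Λ) :
    ∃ (s : Finset M) (B : M → Set M) (a : ℝ), 0 < a ∧ (∀ i, IsCompact (B i)) ∧
      (∀ i, B i ⊆ (chartAt E i).source) ∧ (∀ x ∈ Λ, ∃ i ∈ s, x ∈ B i) ∧
      ∀ i ∈ s, ∀ x ∈ B i, ChartDistortionLE g a i x := by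
  choose a ha using eventually_chartDistortionLE g
  have : ∀ i : M, ∃ B ∈ 𝓝 i, B ⊆ (chartAt E i).source ∩ {x | ChartDistortionLE g (a i) i x} ∧
      IsCompact B := fun i ↦ local_compact_nhds
    (inter_mem ((chartAt E i).open_source.mem_nhds (mem_chart_source E i)) (ha i))
  choose B hB hBs hBc using this
  obtain ⟨s, -, hs⟩ := hΛ.elim_nhds_subcover B fun x _ ↦ hB x
  refine ⟨s, B, 1 + ∑ i ∈ s, |a i|, by positivity, hBc,
    fun i ↦ (hBs i).trans inter_subset_left, fun x hx ↦ by simpa using hs hx,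
    fun i hi x hx ↦ ((hBs i hx).2 : ChartDistortionLE g (a i) i x).mono ?_⟩
  have := Finset.single_le_sum (f := fun i ↦ |a i|) (fun i _ ↦ abs_nonneg _) hi
  have := le_abs_self (a i)
  linarith

end TangentNorm

/-! ### From the hyperbolic splitting to hyperbolic sequences. -/

section Orbits

variable {E : Type*} [NormedAddCommGroup E] [NormedSpace ℝ E]
  {M : Type*} [TopologicalSpace M] [ChartedSpace E M] [IsManifold 𝓘(ℝ, E) ∞ M]

lemma iterate_eq_of_orbit {X : Type*} {f : X → X} {x : ℤ → X} (hx : ∀ n, x (n + 1) = f (x n))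
    (n : ℤ) (k : ℕ) : x (n + k) = f^[k] (x n) := by
  induction k with
  | zero => simp
  | succ k ih => rw [iterate_succ_apply', ← ih, ← hx]; push_cast; rw [add_assoc]

/-- The derivatives of `f` along an orbit, read in charts. -/
def orbitDeriv (E : Type*) [NormedAddCommGroup E] [NormedSpace ℝ E] {M : Type*}
    [TopologicalSpace M] [ChartedSpace E M] (f : M → M) (x c : ℤ → M) (n : ℤ) : E →L[ℝ] E :=
  fderiv ℝ (localRep f (c n) (c (n + 1))) (chartAt E (c n) (x n))

lemma orbitDeriv_apply {f : M → M} (hf : ContMDiff 𝓘(ℝ, E) 𝓘(ℝ, E) 1 f) {x c : ℤ → M}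
    (hx : ∀ n, x (n + 1) = f (x n)) (hc : ∀ n, x n ∈ (chartAt E (c n)).source) (n : ℤ)
    (v : TangentSpace 𝓘(ℝ, E) (x n)) :
    orbitDeriv E f x c n (chartDeriv (c n) (x n) v) =
      chartDeriv (c (n + 1)) (f (x n)) (mfderiv 𝓘(ℝ, E) 𝓘(ℝ, E) f (x n) v) :=
  fderiv_localRep_chartAt hf (hc n) (hx n ▸ hc (n + 1)) v

/-- By the chain rule the intermediate charts cancel; only those at the two ends remain. Hence the
distortion does not accumulate with `k`. -/
lemma cocycle_orbitDeriv {f : M → M} (hf : ContMDiff 𝓘(ℝ, E) 𝓘(ℝ, E) 1 f) {x c : ℤ → M}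
    (hx : ∀ n, x (n + 1) = f (x n)) (hc : ∀ n, x n ∈ (chartAt E (c n)).source) (n : ℤ) (k : ℕ)
    (v : TangentSpace 𝓘(ℝ, E) (x n)) :
    cocycle (orbitDeriv E f x c) n k (chartDeriv (c n) (x n) v) =
      chartDeriv (c (n + k)) (f^[k] (x n)) (mfderiv 𝓘(ℝ, E) 𝓘(ℝ, E) f^[k] (x n) v) := by
  induction k with
  | zero =>
    have h : mfderiv 𝓘(ℝ, E) 𝓘(ℝ, E) f^[0] (x n) v = v := by
      rw [iterate_zero, mfderiv_id]; rfl
    rw [h, cocycle_zero, Nat.cast_zero, add_zero]; rfl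
  | succ k ih =>
    have hk : MDifferentiableAt 𝓘(ℝ, E) 𝓘(ℝ, E) f^[k] (x n) :=
      (hf.iterate k).mdifferentiableAt one_ne_zero
    have hc' : f^[k] (x n) ∈ (chartAt E (c (n + k))).source := by
      rw [← iterate_eq_of_orbit hx]; exact hc _
    have hc'' : f (f^[k] (x n)) ∈ (chartAt E (c (n + k + 1))).source := by
      rw [← iterate_eq_of_orbit hx, ← hx]; exact hc _
    rw [cocycle_succ, ih, orbitDeriv, iterate_eq_of_orbit hx]
    have h1 := fderiv_localRep_chartAt hf hc' hc'' (mfderiv 𝓘(ℝ, E) 𝓘(ℝ, E) f^[k] (x n) v)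
    have h2 : mfderiv 𝓘(ℝ, E) 𝓘(ℝ, E) f^[k + 1] (x n) v =
        mfderiv 𝓘(ℝ, E) 𝓘(ℝ, E) f (f^[k] (x n)) (mfderiv 𝓘(ℝ, E) 𝓘(ℝ, E) f^[k] (x n) v) := by
      rw [iterate_succ', mfderiv_comp (x n) (hf.mdifferentiableAt one_ne_zero) hk]
      rfl
    refine h1.trans ?_
    rw [h2, iterate_succ_apply', Nat.cast_succ, ← add_assoc]
    rfl

/-- This converts contraction of `Eu` under `f⁻¹` into expansion under `f`. Comparing lengths avoids
identifying vectors over `f.symm^[k] (f^[k] x)` with vectors over `x`. -/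
lemma tangentNorm_symm_iterate
    (g : ContinuousRiemannianMetric E (fun x : M ↦ TangentSpace 𝓘(ℝ, E) x))
    (f : M ≃ₘ^1⟮𝓘(ℝ, E), 𝓘(ℝ, E)⟯ M) (k : ℕ) (x : M) (v : TangentSpace 𝓘(ℝ, E) x) :
    tangentNorm g (f.symm^[k] (f^[k] x)) (mfderiv 𝓘(ℝ, E) 𝓘(ℝ, E) f.symm^[k] (f^[k] x)
      (mfderiv 𝓘(ℝ, E) 𝓘(ℝ, E) f^[k] x v)) = tangentNorm g x v := by
  have h1 : MDifferentiableAt 𝓘(ℝ, E) 𝓘(ℝ, E) f^[k] x :=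
    (f.contMDiff.iterate k).mdifferentiableAt one_ne_zero
  have h2 : MDifferentiableAt 𝓘(ℝ, E) 𝓘(ℝ, E) f.symm^[k] (f^[k] x) :=
    (f.symm.contMDiff.iterate k).mdifferentiableAt one_ne_zero
  have h3 : f.symm^[k] ∘ f^[k] = id :=
    funext (LeftInverse.iterate (f := f) (g := f.symm) f.symm_apply_apply k)
  have h4 : tangentNorm g ((f.symm^[k] ∘ f^[k]) x)
      (mfderiv 𝓘(ℝ, E) 𝓘(ℝ, E) (f.symm^[k] ∘ f^[k]) x v) = tangentNorm g x v := by
    rw [h3, mfderiv_id]; rfl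
  rw [← h4, mfderiv_comp x h2 h1]
  rfl

/-- The derivatives along an orbit in a hyperbolic set form a hyperbolic sequence. -/
theorem isHyperbolicSequence_orbitDeriv
    (g : ContinuousRiemannianMetric E (fun x : M ↦ TangentSpace 𝓘(ℝ, E) x))
    (f : M ≃ₘ^1⟮𝓘(ℝ, E), 𝓘(ℝ, E)⟯ M) {Λ : Set M}
    {Es Eu : ∀ x : M, Submodule ℝ (TangentSpace 𝓘(ℝ, E) x)} {lam C a K : ℝ}
    (hcompl : ∀ x ∈ Λ, IsCompl (Es x) (Eu x))
    (hEs : ∀ x ∈ Λ, (Es x).map (mfderiv 𝓘(ℝ, E) 𝓘(ℝ, E) f x).toLinearMap = Es (f x))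
    (hEu : ∀ x ∈ Λ, (Eu x).map (mfderiv 𝓘(ℝ, E) 𝓘(ℝ, E) f x).toLinearMap = Eu (f x))
    (hlam : 0 < lam) (hC : 0 < C) (ha : 0 < a)
    (hyp : ∀ x ∈ Λ, ∀ n : ℕ,
        (∀ v ∈ Es x, tangentNorm g (f^[n] x) (mfderiv 𝓘(ℝ, E) 𝓘(ℝ, E) f^[n] x v) ≤
            C * lam ^ n * tangentNorm g x v) ∧
        (∀ v ∈ Eu x, tangentNorm g (f.symm^[n] x) (mfderiv 𝓘(ℝ, E) 𝓘(ℝ, E) f.symm^[n] x v) ≤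
            C * lam ^ n * tangentNorm g x v))
    {x c : ℤ → M} (hx : ∀ n, x (n + 1) = f (x n)) (hxΛ : ∀ n, x n ∈ Λ)
    (hc : ∀ n, x n ∈ (chartAt E (c n)).source) (hdist : ∀ n, ChartDistortionLE g a (c n) (x n))
    (hK : ∀ n, ‖orbitDeriv E f x c n‖ ≤ K) :
    ∃ S U : ℤ → Submodule ℝ E,
      IsHyperbolicSequence (orbitDeriv E f x c) S U K (a * a * C) lam := by
  have : IsManifold 𝓘(ℝ, E) 1 M := .of_le (n := ∞) (by exact_mod_cast le_top)
  let P : ∀ n, TangentSpace 𝓘(ℝ, E) (x n) →ₗ[ℝ] E := fun n ↦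
    (chartDeriv (c n) (x n)).toLinearMap
  have hmem : ∀ V : ∀ x : M, Submodule ℝ (TangentSpace 𝓘(ℝ, E) x),
      (∀ x ∈ Λ, (V x).map (mfderiv 𝓘(ℝ, E) 𝓘(ℝ, E) f x).toLinearMap = V (f x)) →
      ∀ n, ∀ v ∈ (V (x n)).map (P n),
        orbitDeriv E f x c n v ∈ (V (x (n + 1))).map (P (n + 1)) := by
    rintro V hV n _ ⟨v, hv, rfl⟩
    have h1 : mfderiv 𝓘(ℝ, E) 𝓘(ℝ, E) f (x n) v ∈ V (f (x n)) :=
      hV (x n) (hxΛ n) ▸ Submodule.mem_map_of_mem hv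
    have h2 := orbitDeriv_apply f.contMDiff hx hc n v
    simp only [P]
    rw [hx n]
    exact ⟨_, h1, h2.symm⟩
  have hiter : ∀ (k : ℕ) (y : M) (v : TangentSpace 𝓘(ℝ, E) y), y ∈ Λ → (∀ k, f^[k] y ∈ Λ) →
      v ∈ Eu y → mfderiv 𝓘(ℝ, E) 𝓘(ℝ, E) f^[k] y v ∈ Eu (f^[k] y) := by
    intro k y v hy hyk hv
    induction k with
    | zero =>
      have : mfderiv 𝓘(ℝ, E) 𝓘(ℝ, E) f^[0] y v = v := by
        rw [iterate_zero, mfderiv_id]; rfl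
      rw [this]; exact hv
    | succ k ih =>
      have hk : MDifferentiableAt 𝓘(ℝ, E) 𝓘(ℝ, E) f^[k] y :=
        (f.contMDiff.iterate k).mdifferentiableAt one_ne_zero
      have h1 := hEu _ (hyk k) ▸ Submodule.mem_map_of_mem
        (f := (mfderiv 𝓘(ℝ, E) 𝓘(ℝ, E) f (f^[k] y)).toLinearMap) ih
      have h2 : mfderiv 𝓘(ℝ, E) 𝓘(ℝ, E) f^[k + 1] y v =
          mfderiv 𝓘(ℝ, E) 𝓘(ℝ, E) f (f^[k] y) (mfderiv 𝓘(ℝ, E) 𝓘(ℝ, E) f^[k] y v) := by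
        rw [iterate_succ', mfderiv_comp y (f.contMDiff.mdifferentiableAt one_ne_zero) hk]
        rfl
      rw [h2, iterate_succ_apply']
      exact h1
  have hxk : ∀ n (k : ℕ), f^[k] (x n) ∈ Λ := fun n k ↦ iterate_eq_of_orbit hx n k ▸ hxΛ _
  have hdist' : ∀ n (k : ℕ), ChartDistortionLE g a (c (n + k)) (f^[k] (x n)) := fun n k ↦
    iterate_eq_of_orbit hx n k ▸ hdist (n + k)
  -- The splitting is transported by the chart derivatives. The factor `a * a` in the constant comes
  -- from the distortion at the first and the last point.
  refine ⟨fun n ↦ (Es (x n)).map (P n), fun n ↦ (Eu (x n)).map (P n), hK, fun n w ↦ ?_,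
    hmem Es hEs, hmem Eu hEu, fun n v hv ↦ ?_, ?_, ?_⟩
  · obtain ⟨v, rfl⟩ : ∃ v, P n v = w := (mdifferentiable_chart (c n)).mfderiv_surjective (hc n) w
    have hv : v ∈ Es (x n) ⊔ Eu (x n) := by
      rw [(hcompl _ (hxΛ n)).sup_eq_top]; trivial
    obtain ⟨s, hs, u, hu, rfl⟩ := Submodule.mem_sup.1 hv
    exact ⟨_, Submodule.mem_map_of_mem hs, _, Submodule.mem_map_of_mem hu, (map_add _ _ _).symm⟩
  · simp only [P] at hv
    rw [hx n, ← hEu _ (hxΛ n)] at hv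
    obtain ⟨_, ⟨u, hu, rfl⟩, rfl⟩ := hv
    exact ⟨_, Submodule.mem_map_of_mem hu, orbitDeriv_apply f.contMDiff hx hc n u⟩
  · rintro n k _ ⟨v, hv, rfl⟩
    have e : cocycle (orbitDeriv E f x c) n k (P n v) = _ :=
      cocycle_orbitDeriv f.contMDiff hx hc n k v
    rw [e]
    have h1 := (hdist' n k (mfderiv 𝓘(ℝ, E) 𝓘(ℝ, E) f^[k] (x n) v)).1
    have h2 := (hyp _ (hxΛ n) k).1 v hv
    have h3 : tangentNorm g (x n) v ≤ a * ‖P n v‖ := (hdist n v).2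
    calc _ ≤ _ := h1
      _ ≤ a * (C * lam ^ k * (a * ‖P n v‖)) := by
        refine mul_le_mul_of_nonneg_left (h2.trans ?_) ha.le
        gcongr
      _ = _ := by ring
  · rintro n k _ ⟨v, hv, rfl⟩
    have e : cocycle (orbitDeriv E f x c) n k (P n v) = _ :=
      cocycle_orbitDeriv f.contMDiff hx hc n k v
    have h1 := (hdist' n k (mfderiv 𝓘(ℝ, E) 𝓘(ℝ, E) f^[k] (x n) v)).2
    have h2 := (hyp _ (hxk n k) k).2 _ (hiter k _ v (hxΛ n) (hxk n) hv)
    rw [tangentNorm_symm_iterate] at h2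
    have h3 : ‖P n v‖ ≤ a * tangentNorm g (x n) v := (hdist n v).1
    calc ‖P n v‖ ≤ _ := h3
      _ ≤ a * (C * lam ^ k * (a * ‖cocycle (orbitDeriv E f x c) n k (P n v)‖)) := by
        refine mul_le_mul_of_nonneg_left (h2.trans ?_) ha.le
        rw [e]
        gcongr
      _ = _ := by ring

end Orbits

/-! ### Uniform estimates for charts and for local representatives. -/

section UniformEstimates

/-- Compactness of `B` leaves room inside the source and makes continuity at points of `B` uniform,
also against points outside `B`. Applied to charts and their inverses, it converts between distances
in `M` and in `E`. -/
lemma OpenPartialHomeomorph.eventually_dist_le {X Y : Type*} [PseudoMetricSpace X]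
    [PseudoMetricSpace Y] (e : OpenPartialHomeomorph X Y) {B : Set X} (hB : IsCompact B)
    (hBe : B ⊆ e.source) {ε : ℝ} (hε : 0 < ε) :
    ∀ᶠ δ in 𝓝[>] (0 : ℝ), ∀ x ∈ B, ∀ y, dist y x ≤ δ → y ∈ e.source ∧ dist (e y) (e x) ≤ ε := by
  obtain ⟨δ₁, hδ₁, h1⟩ := hB.exists_cthickening_subset_open e.open_source hBe
  have h2 := hB.uniformContinuousAt_of_continuousAt e (fun a ha ↦ e.continuousAt (hBe ha))
    (Metric.dist_mem_uniformity hε)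
  obtain ⟨δ₂, hδ₂, h2⟩ := Metric.mem_uniformity_dist.1 h2
  filter_upwards [Ioo_mem_nhdsGT (lt_min hδ₁ hδ₂)] with δ hδ x hx y hy
  refine ⟨h1 (mem_cthickening_of_dist_le y x δ₁ B hx
    (hy.trans (hδ.2.le.trans (min_le_left _ _)))), ?_⟩
  have : dist x y < δ₂ := by
    rw [dist_comm]
    exact hy.trans_lt (hδ.2.trans_le (min_le_right _ _))
  have := h2 this hx
  rw [dist_comm]
  exact this.le

variable {E : Type*} [NormedAddCommGroup E] [NormedSpace ℝ E]
  {M : Type*} [TopologicalSpace M] [ChartedSpace E M]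

lemma localRep_mem_localDom_symm (f : M ≃ₘ^1⟮𝓘(ℝ, E), 𝓘(ℝ, E)⟯ M) {i j : M} {q : E}
    (hq : q ∈ localDom E f i j) : localRep f i j q ∈ localDom E f.symm j i := by
  refine ⟨(chartAt E j).map_source hq.2, ?_⟩
  have : (chartAt E j).symm (localRep f i j q) = f ((chartAt E i).symm q) :=
    (chartAt E j).left_inv hq.2
  rw [mem_preimage, this, mem_preimage, f.symm_apply_apply]
  exact (chartAt E i).map_target hq.1

lemma localRep_symm_localRep (f : M ≃ₘ^1⟮𝓘(ℝ, E), 𝓘(ℝ, E)⟯ M) {i j : M} {q : E}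
    (hq : q ∈ localDom E f i j) : localRep f.symm j i (localRep f i j q) = q := by
  have : (chartAt E j).symm (localRep f i j q) = f ((chartAt E i).symm q) :=
    (chartAt E j).left_inv hq.2
  rw [localRep, this, f.symm_apply_apply]
  exact (chartAt E i).right_inv hq.1

variable [IsManifold 𝓘(ℝ, E) ∞ M]

lemma fderiv_localRep_symm_apply (f : M ≃ₘ^1⟮𝓘(ℝ, E), 𝓘(ℝ, E)⟯ M) {i j : M} {q : E}
    (hq : q ∈ localDom E f i j) (w : E) :
    fderiv ℝ (localRep f.symm j i) (localRep f i j q) (fderiv ℝ (localRep f i j) q w) = w := by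
  have h1 := (differentiableAt_localRep f.contMDiff hq).hasFDerivAt
  have h2 := (differentiableAt_localRep f.symm.contMDiff
    (localRep_mem_localDom_symm f hq)).hasFDerivAt
  have h3 : localRep f.symm j i ∘ localRep f i j =ᶠ[𝓝 q] id := by
    filter_upwards [(isOpen_localDom f.continuous i j).mem_nhds hq] with p hp
    exact localRep_symm_localRep f hp
  have h4 := (h2.comp q h1).unique ((hasFDerivAt_id q).congr_of_eventuallyEq h3)
  exact DFunLike.congr_fun h4 w

/-- The derivatives of the local representatives of a diffeomorphism and their inverses are
bounded on compact sets. -/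
lemma eventually_norm_fderiv_localRep_le (f : M ≃ₘ^1⟮𝓘(ℝ, E), 𝓘(ℝ, E)⟯ M) (i j : M) {Q : Set E}
    (hQ : IsCompact Q) (hQd : Q ⊆ localDom E f i j) :
    ∀ᶠ κ in (atTop : Filter ℝ), ∀ q ∈ Q, ‖fderiv ℝ (localRep f i j) q‖ ≤ κ ∧
      ∀ w, ‖w‖ ≤ κ * ‖fderiv ℝ (localRep f i j) q w‖ := by
  have hd := contDiffOn_localRep f.contMDiff i j
  have hd' := contDiffOn_localRep f.symm.contMDiff j i
  obtain ⟨a, ha⟩ := hQ.exists_bound_of_continuousOn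
    ((hd.continuousOn_fderiv_of_isOpen (isOpen_localDom f.continuous i j) le_rfl).mono hQd)
  obtain ⟨b, hb⟩ := hQ.exists_bound_of_continuousOn
    ((hd'.continuousOn_fderiv_of_isOpen (isOpen_localDom f.symm.continuous j i) le_rfl).comp
      (hd.continuousOn.mono hQd) fun q hq ↦ localRep_mem_localDom_symm f (hQd hq))
  filter_upwards [eventually_ge_atTop a, eventually_ge_atTop b] with κ hκa hκb q hq
  refine ⟨(ha q hq).trans hκa, fun w ↦ ?_⟩
  conv_lhs => rw [← fderiv_localRep_symm_apply f (hQd hq) w]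
  refine (ContinuousLinearMap.le_opNorm _ _).trans ?_
  gcongr
  exact (hb q hq).trans hκb

end UniformEstimates

/-! ### Unique shadowing in a hyperbolic set. -/

section Shadowing

/-- Every `f`-orbit in `Λ` is `ρ`-shadowed by an `f'`-orbit, and by only one, even at the distance
`2 * ρ`; moreover `f'` is injective on the points that can occur in such orbits. -/
structure IsShadowing {M : Type*} [PseudoMetricSpace M] (f f' : M → M) (Λ : Set M) (ρ : ℝ) :
    Prop where
  exists_orbit : ∀ x : ℤ → M, (∀ n, x n ∈ Λ) → (∀ n, x (n + 1) = f (x n)) →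
    ∃ y : ℤ → M, (∀ n, y (n + 1) = f' (y n)) ∧ ∀ n, dist (y n) (x n) ≤ ρ
  orbit_unique : ∀ x : ℤ → M, (∀ n, x n ∈ Λ) → (∀ n, x (n + 1) = f (x n)) → ∀ y y' : ℤ → M,
    (∀ n, y (n + 1) = f' (y n)) → (∀ n, dist (y n) (x n) ≤ 2 * ρ) →
    (∀ n, y' (n + 1) = f' (y' n)) → (∀ n, dist (y' n) (x n) ≤ 2 * ρ) → y = y'
  eq_of_eq : ∀ p ∈ Λ, ∀ p' ∈ Λ, ∀ y y', dist y p ≤ ρ → dist y' p' ≤ ρ → dist (f' y) (f p) ≤ ρ →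
    dist (f' y') (f p') ≤ ρ → f' y = f' y' → y = y'

variable {E : Type*} [NormedAddCommGroup E] [NormedSpace ℝ E] [FiniteDimensional ℝ E]
  {M : Type*} [MetricSpace M] [ChartedSpace E M] [IsManifold 𝓘(ℝ, E) ∞ M]

/-- Orbits in a uniformly hyperbolic set are uniquely shadowed by orbits of `C¹`-close maps. -/
theorem IsUniformlyHyperbolic.exists_isShadowing (f : M ≃ₘ^1⟮𝓘(ℝ, E), 𝓘(ℝ, E)⟯ M) {Λ : Set M}
    (hΛ : IsUniformlyHyperbolic f Λ) {ρ₀ : ℝ} (hρ₀ : 0 < ρ₀) :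
    ∃ ρ > 0, ρ ≤ ρ₀ ∧ ∀ᶠ f' : C^1⟮𝓘(ℝ, E), M; 𝓘(ℝ, E), M⟯ in @nhds _ weakC1Topology
      (f : C^1⟮𝓘(ℝ, E), M; 𝓘(ℝ, E), M⟯), IsShadowing f f' Λ ρ := by
  have : CompleteSpace E := FiniteDimensional.complete ℝ E
  have : ProperSpace E := FiniteDimensional.proper_real E
  have : LocallyCompactSpace M := Manifold.locallyCompact_of_finiteDimensional 𝓘(ℝ, E)
  obtain ⟨hΛc, him, g, Es, Eu, -, -, hcompl, hEs, hEu, lam, C, hlam, hlam1, hC, hyp⟩ := hΛ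
  have hfΛ : ∀ x ∈ Λ, f x ∈ Λ := fun x hx ↦ him ▸ mem_image_of_mem f hx
  obtain ⟨s, B, a, ha, hBc, hBs, hcov, hdist⟩ := exists_chart_cover g hΛc
  have hD : ∀ i j, IsCompact (Λ ∩ B i ∩ f ⁻¹' B j) := fun i j ↦
    (hΛc.inter_right (hBc i).isClosed).inter_right ((hBc j).isClosed.preimage f.continuous)
  let Q : M → M → Set E := fun i j ↦ chartAt E i '' (Λ ∩ B i ∩ f ⁻¹' B j)
  have hQ : ∀ i j, IsCompact (Q i j) := fun i j ↦ (hD i j).image_of_continuousOn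
    ((chartAt E i).continuousOn.mono fun x hx ↦ hBs i hx.1.2)
  have hQd : ∀ i j, Q i j ⊆ localDom E f i j := by
    rintro i j _ ⟨x, hx, rfl⟩
    exact chartAt_mem_localDom (hBs i hx.1.2) (hBs j hx.2)
  have hall : ∀ {l : Filter ℝ} {p : M → M → ℝ → Prop}, (∀ i j, ∀ᶠ t in l, p i j t) →
      ∀ᶠ t in l, ∀ i ∈ s, ∀ j ∈ s, p i j t := fun h ↦
    (eventually_all_finset s).2 fun i _ ↦ (eventually_all_finset s).2 fun j _ ↦ h i j
  obtain ⟨κ, hκ, hκ0⟩ := ((hall fun i j ↦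
    eventually_norm_fderiv_localRep_le f i j (hQ i j) (hQd i j)).and
      (eventually_gt_atTop 0)).exists
  obtain ⟨R, hR, hshadow⟩ := exists_unique_orbit_of_isHyperbolicSequence (E := E) κ
    (show 0 < a * a * C by positivity) hlam hlam1
  -- The error `2 * ε` will be one `ε` for `f` against its linear part and one for `f'` against `f`.
  -- It must be small against `R` for the fixed point argument and against `κ` for injectivity.
  set ε : ℝ := 1 / (4 * (R + κ))
  have hε : 0 < ε := by positivity
  have hRε : R * (2 * ε) ≤ 1 / 2 := by
    simp only [ε]; rw [mul_one_div, mul_div_assoc', div_le_iff₀ (by positivity)]; linarith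
  have hκε : κ * (2 * ε) ≤ 1 / 2 := by
    simp only [ε]; rw [mul_one_div, mul_div_assoc', div_le_iff₀ (by positivity)]; linarith
  obtain ⟨δ, hδ, hδ0⟩ := ((hall fun i j ↦ eventually_norm_fderiv_sub_le
    (isOpen_localDom f.continuous i j) (contDiffOn_localRep f.contMDiff i j) (hQ i j)
    (hQd i j) hε).and self_mem_nhdsWithin).exists
  obtain ⟨ρ₁, hρ₁, hρ₁0⟩ := (((eventually_all_finset s).2 fun i _ ↦
    (chartAt E i).eventually_dist_le (hBc i) (hBs i) hδ0).and self_mem_nhdsWithin).exists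
  obtain ⟨r, hr0, hr⟩ := Metric.uniformContinuousOn_iff.1
    (hΛc.uniformContinuousOn_of_continuous f.symm.continuous.continuousOn) (ρ₁ / 2) (by positivity)
  -- `2 * ρ < ρ₁` keeps the orbits in the uniqueness claim inside the charts. If the `ρ`-balls about
  -- `f p` and `f p'` meet, `2 * ρ < r` makes `p` and `p'` close.
  obtain ⟨ρ, hρ0, hρ⟩ : ∃ ρ > 0, ρ < min ρ₀ (min (ρ₁ / 2) (r / 2)) :=
    exists_between (by positivity)
  obtain ⟨hρρ₀, hρρ₁, hρr⟩ : ρ < ρ₀ ∧ ρ < ρ₁ / 2 ∧ ρ < r / 2 := by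
    simpa only [lt_min_iff] using hρ
  obtain ⟨δ', hδ', hδ'δ⟩ := (((eventually_all_finset s).2 fun i _ ↦
    (chartAt E i).symm.eventually_dist_le
      ((hBc i).image_of_continuousOn ((chartAt E i).continuousOn.mono (hBs i)))
      (by rintro _ ⟨x, hx, rfl⟩; exact (chartAt E i).map_source (hBs i hx)) hρ0).and
    (Ioo_mem_nhdsGT hδ0)).exists
  -- A defect `η` yields displacements of size at most `2 * R * η = δ'`, that is, points of `M` at
  -- distance at most `ρ`.
  set η : ℝ := δ' / (2 * R)
  have hη : 0 < η := div_pos hδ'δ.1 (by positivity)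
  have hRη : 2 * R * η = δ' := by simp only [η]; field_simp
  refine ⟨ρ, hρ0, hρρ₀.le, ?_⟩
  have hclose := (eventually_all_finset s).2 fun i hi ↦ (eventually_all_finset s).2 fun j hj ↦
    eventually_localRep_close (f : C^1⟮𝓘(ℝ, E), M; 𝓘(ℝ, E), M⟯) i j (hQ i j).cthickening
      (hδ i hi j hj).1 (lt_min hε hη)
  filter_upwards [hclose] with f' hf'
  have hlip : ∀ i ∈ s, ∀ j ∈ s, ∀ p ∈ Q i j, ∀ q ∈ closedBall p δ, ∀ q' ∈ closedBall p δ,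
      ‖localRep f' i j q - localRep f' i j q' - fderiv ℝ (localRep f i j) p (q - q')‖ ≤
        2 * ε * ‖q - q'‖ := by
    intro i hi j hj p hp q hq q' hq'
    have hsub : closedBall p δ ⊆ cthickening δ (Q i j) := closedBall_subset_cthickening hp δ
    refine (convex_closedBall p δ).norm_image_sub_le_of_norm_fderiv_le' (𝕜 := ℝ)
      (fun z hz ↦ differentiableAt_localRep f'.contMDiff (hf' i hi j hj z (hsub hz)).1)
      (fun z hz ↦ ?_) hq' hq
    have h1 := (hf' i hi j hj z (hsub hz)).2.2.trans (min_le_left _ _)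
    have h2 := (hδ i hi j hj).2 p hp z hz
    calc _ ≤ _ := norm_sub_le_norm_sub_add_norm_sub _ (fderiv ℝ (localRep f i j) z) _
      _ ≤ ε + ε := add_le_add h1 h2
      _ = _ := by ring
  have hcharts : ∀ x : ℤ → M, (∀ n, x n ∈ Λ) → (∀ n, x (n + 1) = f (x n)) →
      ∃ c : ℤ → M, (∀ n, c n ∈ s) ∧ (∀ n, x n ∈ B (c n)) ∧
        (∀ n, chartAt E (c n) (x n) ∈ Q (c n) (c (n + 1))) ∧
        ∃ S U, IsHyperbolicSequence (orbitDeriv E f x c) S U κ (a * a * C) lam := by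
    intro x hxΛ hx
    -- The charts are chosen independently at each time; only their finite number matters.
    choose c hcs hcB using fun n ↦ hcov (x n) (hxΛ n)
    have hcQ : ∀ n, chartAt E (c n) (x n) ∈ Q (c n) (c (n + 1)) := fun n ↦
      ⟨x n, ⟨⟨hxΛ n, hcB n⟩, show f (x n) ∈ _ from hx n ▸ hcB (n + 1)⟩, rfl⟩
    exact ⟨c, hcs, hcB, hcQ, isHyperbolicSequence_orbitDeriv g f hcompl hEs hEu hlam hC ha hyp hx
      hxΛ (fun n ↦ hBs _ (hcB n)) (fun n ↦ hdist _ (hcs n) _ (hcB n))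
      fun n ↦ (hκ _ (hcs n) _ (hcs (n + 1)) _ (hcQ n)).1⟩
  have hmain : ∀ (x c : ℤ → M), (∀ n, c n ∈ s) →
      (∀ n, chartAt E (c n) (x n) ∈ Q (c n) (c (n + 1))) →
      ∀ n, ∀ v ∈ closedBall (0 : E) δ, ∀ w ∈ closedBall (0 : E) δ,
      ‖(localRep f' (c n) (c (n + 1)) (chartAt E (c n) (x n) + v) -
          chartAt E (c (n + 1)) (x (n + 1))) -
        (localRep f' (c n) (c (n + 1)) (chartAt E (c n) (x n) + w) -
          chartAt E (c (n + 1)) (x (n + 1))) - orbitDeriv E f x c n (v - w)‖ ≤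
        2 * ε * ‖v - w‖ := by
    intro x c hcs hcQ n v hv w hw
    have := hlip _ (hcs n) _ (hcs (n + 1)) _ (hcQ n) (chartAt E (c n) (x n) + v)
      (by simpa using hv) (chartAt E (c n) (x n) + w) (by simpa using hw)
    rw [add_sub_add_left_eq_sub] at this
    rwa [sub_sub_sub_cancel_right]
  refine ⟨fun x hxΛ hx ↦ ?_, fun x hxΛ hx y y' hy hyx hy' hyx' ↦ ?_,
    fun p hp p' hp' y y' hyp hyp' hfy hfy' heq ↦ ?_⟩
  · obtain ⟨c, hcs, hcB, hcQ, S, U, hyps⟩ := hcharts x hxΛ hx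
    obtain ⟨v, hv, hvo⟩ := (hshadow hyps _ δ (2 * ε) hRε (hmain x c hcs hcQ)).2 η (fun n ↦ by
      rw [add_zero, hx, ← localRep_chartAt f (c (n + 1)) (hBs _ (hcB n))]
      exact (hf' _ (hcs n) _ (hcs (n + 1)) _ (self_subset_cthickening _ (hcQ n))).2.1.trans
        (min_le_right _ _)) (hRη ▸ hδ'δ.2.le)
    rw [hRη] at hv
    refine ⟨fun n ↦ (chartAt E (c n)).symm (chartAt E (c n) (x n) + v n), fun n ↦ ?_, fun n ↦ ?_⟩
    · have hmem : chartAt E (c n) (x n) + v n ∈ localDom E f' (c n) (c (n + 1)) :=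
        (hf' _ (hcs n) _ (hcs (n + 1)) _ (closedBall_subset_cthickening (hcQ n) δ
          (by simpa using (hv n).trans hδ'δ.2.le))).1
      simp only [hvo n]
      rw [add_sub_cancel]
      exact (chartAt E (c (n + 1))).left_inv hmem.2
    · have := (hδ' _ (hcs n) _ (mem_image_of_mem _ (hcB n)) (chartAt E (c n) (x n) + v n)
        (by simpa using hv n)).2
      rwa [(chartAt E (c n)).left_inv (hBs _ (hcB n))] at this
  · obtain ⟨c, hcs, hcB, hcQ, S, U, hyps⟩ := hcharts x hxΛ hx
    have hcoord : ∀ y : ℤ → M, (∀ n, dist (y n) (x n) ≤ 2 * ρ) → ∀ n,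
        y n ∈ (chartAt E (c n)).source ∧
        ‖chartAt E (c n) (y n) - chartAt E (c n) (x n)‖ ≤ δ := by
      intro y hyx n
      rw [← dist_eq_norm]
      exact hρ₁ _ (hcs n) _ (hcB n) _ ((hyx n).trans (by linarith))
    have horb : ∀ y : ℤ → M, (∀ n, dist (y n) (x n) ≤ 2 * ρ) → (∀ n, y (n + 1) = f' (y n)) → ∀ n,
        chartAt E (c (n + 1)) (y (n + 1)) - chartAt E (c (n + 1)) (x (n + 1)) =
          localRep f' (c n) (c (n + 1)) (chartAt E (c n) (x n) +
            (chartAt E (c n) (y n) - chartAt E (c n) (x n))) -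
          chartAt E (c (n + 1)) (x (n + 1)) := by
      intro y hyx hy n
      rw [add_sub_cancel, localRep_chartAt _ _ (hcoord y hyx n).1, hy]
    have := (hshadow hyps _ δ (2 * ε) hRε (hmain x c hcs hcQ)).1 _ _
      (fun n ↦ (hcoord y hyx n).2) (fun n ↦ (hcoord y' hyx' n).2) (horb y hyx hy)
      (horb y' hyx' hy')
    funext n
    have h1 := sub_left_injective (congrFun this n)
    exact (chartAt E (c n)).injOn (hcoord y hyx n).1 (hcoord y' hyx' n).1 h1
  · obtain ⟨i, hi, hpi⟩ := hcov p hp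
    obtain ⟨j, hj, hpj⟩ := hcov (f p) (hfΛ p hp)
    -- Closeness of `p` and `p'` puts `y` and `y'` in one chart, where `f'` is close to an injective
    -- linear map.
    have hpp : dist p' p < ρ₁ / 2 := by
      have h1 : dist (f p') (f p) < r := by
        rw [heq] at hfy
        have := dist_triangle_left (f p') (f p) (f' y')
        linarith
      simpa using hr _ (hfΛ p' hp') _ (hfΛ p hp) h1
    have hy := hρ₁ i hi p hpi y (by linarith)
    have hy' := hρ₁ i hi p hpi y' (by have := dist_triangle y' p' p; linarith)
    have hpQ : chartAt E i p ∈ Q i j := ⟨p, ⟨⟨hp, hpi⟩, hpj⟩, rfl⟩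
    have h1 := hlip i hi j hj _ hpQ _ hy.2 _ hy'.2
    rw [localRep_chartAt _ _ hy.1, localRep_chartAt _ _ hy'.1, heq, sub_self, zero_sub,
      norm_neg] at h1
    have h2 := (hκ i hi j hj _ hpQ).2 (chartAt E i y - chartAt E i y')
    have h3 : ‖chartAt E i y - chartAt E i y'‖ ≤ 1 / 2 * ‖chartAt E i y - chartAt E i y'‖ :=
      calc _ ≤ _ := h2
        _ ≤ κ * (2 * ε * ‖chartAt E i y - chartAt E i y'‖) := by gcongr
        _ = κ * (2 * ε) * ‖chartAt E i y - chartAt E i y'‖ := by ring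
        _ ≤ _ := by gcongr
    have h4 := norm_nonneg (chartAt E i y - chartAt E i y')
    exact (chartAt E i).injOn hy.1 hy'.1 (sub_eq_zero.1 (norm_le_zero_iff.1 (by linarith)))

end Shadowing

/-! ### From unique shadowing to the conjugacy. -/

section Conjugacy

/-- The projection along a compact factor is closed, so preimages of closed sets are closed. -/
lemma continuous_of_isClosed_setOf_eq {X Y : Type*} [TopologicalSpace X] [TopologicalSpace Y]
    [CompactSpace Y] {h : X → Y} (hc : IsClosed {p : X × Y | p.2 = h p.1}) : Continuous h := by
  refine continuous_iff_isClosed.2 fun F hF ↦ ?_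
  have : h ⁻¹' F = Prod.fst '' ({p : X × Y | p.2 = h p.1} ∩ Prod.snd ⁻¹' F) := by
    ext x
    constructor
    · exact fun hx ↦ ⟨(x, h x), ⟨rfl, hx⟩, rfl⟩
    · rintro ⟨⟨x, y⟩, ⟨hy, hyF⟩, rfl⟩
      simp only [mem_ofPred_eq] at hy
      subst hy
      exact hyF
  rw [this]
  exact isClosedMap_fst_of_compactSpace _ (hc.inter (hF.preimage continuous_snd))

/-- A map all of whose orbits near `Λ` uniquely shadow those of an expansive homeomorphism is
conjugate to it on `Λ`. -/
theorem IsShadowing.exists_conjugacy {M : Type*} [MetricSpace M] {f : M ≃ₜ M} {f' : M → M}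
    {Λ : Set M} {ρ : ℝ} (hf' : Continuous f') (him : f '' Λ = Λ)
    (hcpt : IsCompact (cthickening ρ Λ)) (hinv : MapsTo f Λ Λ) (h : IsShadowing f f' Λ ρ)
    (hexp : IsShadowing f f Λ ρ) :
    ∃ H : C(Λ, M), (∀ x, dist (H x) x ≤ ρ) ∧ Injective H ∧
      f' ∘ H = H ∘ hinv.restrict f Λ Λ := by
  have hinv' : MapsTo f.symm Λ Λ := by
    intro x hx
    rw [← him] at hx
    obtain ⟨y, hy, rfl⟩ := hx
    simpa using hy
  let orb : M → ℤ → M := fun x n ↦ (f ^ n : M ≃ₜ M) x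
  have horb : ∀ x n, orb x (n + 1) = f (orb x n) := fun x n ↦ by
    simp only [orb]
    rw [add_comm, zpow_one_add, Homeomorph.mul_apply]
  have horb' : ∀ x n, orb (f x) n = orb x (n + 1) := fun x n ↦ by
    simp only [orb]
    rw [zpow_add_one, Homeomorph.mul_apply]
  have horbΛ : ∀ x ∈ Λ, ∀ n, orb x n ∈ Λ := by
    intro x hx n
    induction n with
    | zero => simpa [orb] using hx
    | succ n ih => rw [horb]; exact hinv ih
    | pred n ih =>
      have := horb x (-n - 1)
      rw [sub_add_cancel] at this
      rw [this] at ih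
      simpa using hinv' ih
  choose Y hYo hYd using fun x : Λ ↦ h.exists_orbit (orb x) (horbΛ x x.2) (horb x)
  have hdist0 : ∀ x : Λ, dist (Y x 0) x ≤ ρ := fun x ↦ by simpa [orb] using hYd x 0
  have hρ : ∀ x : Λ, 0 ≤ ρ := fun x ↦ dist_nonneg.trans (hdist0 x)
  have huniq : ∀ (x : Λ) (y : ℤ → M), (∀ n, y (n + 1) = f' (y n)) →
      (∀ n, dist (y n) (orb x n) ≤ ρ) → y = Y x := fun x y hy hyd ↦
    h.orbit_unique (orb x) (horbΛ x x.2) (horb x) y (Y x) hy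
      (fun n ↦ (hyd n).trans (by linarith [hρ x])) (hYo x)
      (fun n ↦ (hYd x n).trans (by linarith [hρ x]))
  have hshift : ∀ (x : Λ) n, Y (hinv.restrict f Λ Λ x) n = Y x (n + 1) := by
    intro x n
    have := huniq (hinv.restrict f Λ Λ x) (fun n ↦ Y x (n + 1)) (fun n ↦ hYo x (n + 1)) fun n ↦ by
      have := hYd x (n + 1)
      rwa [← horb'] at this
    exact (congrFun this n).symm
  have : CompactSpace (cthickening ρ Λ) := isCompact_iff_compactSpace.1 hcpt
  -- The whole orbit is recorded as a point of a compact product. By uniqueness, the closed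
  -- conditions of being an `f'`-orbit and `ρ`-shadowing cut out exactly the graph of `Z`.
  let Z : Λ → ℤ → cthickening ρ Λ := fun x n ↦
    ⟨Y x n, mem_cthickening_of_dist_le _ _ _ _ (horbΛ x x.2 n) (hYd x n)⟩
  have hZ : Continuous Z := by
    refine continuous_of_isClosed_setOf_eq ?_
    have : {p : Λ × (ℤ → cthickening ρ Λ) | p.2 = Z p.1} =
        (⋂ n : ℤ, {p | (p.2 (n + 1) : M) = f' (p.2 n)}) ∩
          ⋂ n : ℤ, {p | dist (p.2 n : M) (orb p.1 n) ≤ ρ} := by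
      ext ⟨x, y⟩
      simp only [mem_ofPred_eq, mem_inter_iff, mem_iInter]
      constructor
      · rintro rfl
        exact ⟨hYo x, hYd x⟩
      · rintro ⟨h1, h2⟩
        have := huniq x (fun n ↦ y n) h1 h2
        funext n
        exact Subtype.ext (congrFun this n)
    have hcoe : ∀ n : ℤ, Continuous fun p : Λ × (ℤ → cthickening ρ Λ) ↦ (p.2 n : M) := fun n ↦
      continuous_subtype_val.comp ((continuous_apply n).comp continuous_snd)
    rw [this]
    refine (isClosed_iInter fun n ↦ isClosed_eq (hcoe _) (hf'.comp (hcoe n))).inter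
      (isClosed_iInter fun n ↦ isClosed_le ((hcoe n).dist ?_) continuous_const)
    exact (f ^ n : M ≃ₜ M).continuous.comp (continuous_subtype_val.comp continuous_fst)
  -- As `f'` need not be injective, the past is recovered step by step from `eq_of_eq`.
  have hback : ∀ (x x' : Λ) (n : ℕ), Y x 0 = Y x' 0 → Y x (-n) = Y x' (-n) := by
    intro x x' n h0
    induction n with
    | zero => simpa using h0
    | succ n ih =>
      have e : ∀ x : Λ, Y x (-n) = f' (Y x (-(n + 1 : ℕ))) := fun x ↦ by
        rw [← hYo]; congr 1; push_cast; ring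
      have e' : ∀ x : M, orb x (-n) = f (orb x (-(n + 1 : ℕ))) := fun x ↦ by
        rw [← horb]; congr 1; push_cast; ring
      refine h.eq_of_eq _ (horbΛ x x.2 (-(n + 1 : ℕ))) _ (horbΛ x' x'.2 (-(n + 1 : ℕ))) _ _
        (hYd x _) (hYd x' _) ?_ ?_ ?_
      · rw [← e, ← e']; exact hYd x _
      · rw [← e, ← e']; exact hYd x' _
      · rw [← e, ← e]; exact ih
  have hforw : ∀ (x x' : Λ) (n : ℕ), Y x 0 = Y x' 0 → Y x n = Y x' n := by
    intro x x' n h0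
    induction n with
    | zero => simpa using h0
    | succ n ih => push_cast; rw [hYo, hYo, ih]
  refine ⟨⟨fun x ↦ Y x 0, continuous_subtype_val.comp ((continuous_apply (0 : ℤ)).comp hZ)⟩,
    hdist0, fun x x' hxx' ↦ ?_, ?_⟩
  · have hall : ∀ n, Y x n = Y x' n := fun n ↦ by
      rcases Int.eq_nat_or_neg n with ⟨k, rfl | rfl⟩
      · exact hforw x x' k hxx'
      · exact hback x x' k hxx'
    -- Both `f`-orbits are within `ρ` of the same orbit `Y x`, hence within `2 * ρ` of each other;
    -- this is why uniqueness was required at distance `2 * ρ`.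
    have := hexp.orbit_unique (orb x) (horbΛ x x.2) (horb x) (orb x) (orb x') (horb x)
      (fun n ↦ by simpa using hρ x) (horb x') fun n ↦ by
        have h1 := hYd x n
        have h2 := hYd x' n
        rw [← hall n] at h2
        have := dist_triangle_left (orb x' n) (orb x n) (Y x n)
        linarith
    exact Subtype.ext (by simpa [orb] using congrFun this 0)
  · funext x
    have h1 := hshift x 0
    rw [hYo] at h1
    exact h1.symm

end Conjugacy

theorem theorem3p2 {E : Type*} [NormedAddCommGroup E] [NormedSpace ℝ E] [FiniteDimensional ℝ E]
    {M : Type*} [TopologicalSpace M] [T2Space M] [SecondCountableTopology M]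
    [ChartedSpace E M] [IsManifold 𝓘(ℝ, E) ∞ M]
    (f : M ≃ₘ^1⟮𝓘(ℝ, E), 𝓘(ℝ, E)⟯ M) (Λ : Set M) (hΛ : IsUniformlyHyperbolic f Λ) :
    IsStructurallyStable (f : C^1⟮𝓘(ℝ, E), M; 𝓘(ℝ, E), M⟯) Λ := by
  have : LocallyCompactSpace M := Manifold.locallyCompact_of_finiteDimensional 𝓘(ℝ, E)
  -- Any compatible metric will do; it need not be related to the Riemannian one, since both are
  -- compared only with norms in charts.
  let _ : MetricSpace M := TopologicalSpace.metrizableSpaceMetric M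
  have hinv : MapsTo f Λ Λ := fun x hx ↦ hΛ.image_eq ▸ mem_image_of_mem f hx
  refine ⟨hinv, fun W hW ↦ ?_⟩
  have : CompactSpace Λ := isCompact_iff_compactSpace.1 hΛ.isCompact
  obtain ⟨r, hr, hrW⟩ := Metric.nhds_basis_closedBall.mem_iff.1 hW
  obtain ⟨r', hr', hcpt⟩ := hΛ.isCompact.exists_isCompact_cthickening
  obtain ⟨ρ, hρ, hρr, hN⟩ := hΛ.exists_isShadowing f (lt_min hr hr')
  refine ⟨_, hN, fun f' hf' ↦ ?_⟩
  -- Expansivity of `f` at the same scale `ρ`: `f` lies in its own neighbourhood.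
  have hself : IsShadowing f f Λ ρ := by
    let _ : TopologicalSpace C^1⟮𝓘(ℝ, E), M; 𝓘(ℝ, E), M⟯ := weakC1Topology
    exact hN.self_of_nhds
  have hc : IsCompact (cthickening ρ Λ) :=
    hcpt.of_isClosed_subset isClosed_cthickening (cthickening_mono (hρr.trans (min_le_right _ _)) _)
  obtain ⟨H, hH, hinj, hconj⟩ := IsShadowing.exists_conjugacy (f := f.toHomeomorph)
    f'.contMDiff.continuous hΛ.image_eq hc hinv hf' hself
  refine ⟨H, hrW ?_, hinj, hconj⟩
  exact (ContinuousMap.dist_le hr.le).2 fun x ↦ (hH x).trans (hρr.trans (min_le_left _ _))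

end
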